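/- Let $M$ be a compact complex manifold of complex dimension $n\ge 2$ with a smooth Hermitian metric $g$, let $\omega=\sqrt{-1}\sum_{i,j} g_{i\bar j}\,dz^i\wedge d\bar z^j$ be its associated real $(1,1)$-form, and let $d\mu=\omega^n/\int_M\omega^n$. Let $A$ and $C$ be real constants. Then for every $\alpha>0$ there is a constant $C_\alpha$, depending only on $(M,g)$, $A$, $C$ and $\alpha$, such that the following holds. Let $\varphi:M\to\mathbb{R}$ be a smooth function with $\sup_M\varphi=0$ for which $g'_{i\bar j}=g_{i\bar j}+\partial_i\partial_{\bar j}\varphi$ is positive definite and which satisfies the second-order estimate $$\operatorname{tr}_g g' = g^{i\bar j}g'_{i\bar j}\le C\,e^{A(\varphi-\inf_M\varphi)}\quad\text{on } M.$$ Then $$-\inf_M\varphi\le C_\alpha+\frac1\alpha\log\int_M e^{-\alpha\varphi}\,d\mu .$$ -/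

import Mathlib

open MeasureTheory
open scoped ContDiff Manifold ComplexOrder

noncomputable section

namespace HermitianGeometry

/-- The model space `ℂⁿ` of an `n`-dimensional complex manifold. -/
abbrev CSpace (n : ℕ) : Type := EuclideanSpace ℂ (Fin n)

/-- The standard charted space structure of `ℂⁿ` over itself (a shortcut instance). -/
instance chartedSpaceCSpace (n : ℕ) : ChartedSpace (CSpace n) (CSpace n) := chartedSpaceSelf _

/-- The Wirtinger derivative `∂f/∂zⁱ = (∂f/∂xⁱ - √-1 ∂f/∂yⁱ) / 2`, where `zⁱ = xⁱ + √-1 yⁱ`. -/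
def dz {n : ℕ} (i : Fin n) (f : CSpace n → ℂ) (z : CSpace n) : ℂ :=
  (fderiv ℝ f z (EuclideanSpace.single i 1) - Complex.I * fderiv ℝ f z (EuclideanSpace.single i Complex.I)) / 2

/-- The Wirtinger derivative `∂f/∂z̄ⁱ = (∂f/∂xⁱ + √-1 ∂f/∂yⁱ) / 2`. -/
def dzbar {n : ℕ} (i : Fin n) (f : CSpace n → ℂ) (z : CSpace n) : ℂ :=
  (fderiv ℝ f z (EuclideanSpace.single i 1) + Complex.I * fderiv ℝ f z (EuclideanSpace.single i Complex.I)) / 2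

/-- A smooth Hermitian metric on the complex manifold `M`: a positive definite Hermitian form
`g(v, w)` on every holomorphic tangent space, linear in `v` and conjugate-linear in `w`, whose
coefficients `g_{i j̄} = g(∂_i, ∂_j)` are smooth functions in every holomorphic chart `e` of the
atlas. The coordinate field `∂_i` of `e` is the image of the `i`-th basis vector of `ℂⁿ` under
the differential of `e⁻¹`. -/
structure HermitianMetric (n : ℕ) (M : Type*) [TopologicalSpace M] [ChartedSpace (CSpace n) M] where
  form : ∀ p : M, TangentSpace 𝓘(ℂ, CSpace n) p →ₗ[ℂ] TangentSpace 𝓘(ℂ, CSpace n) p →ₗ⋆[ℂ] ℂ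
  conj_symm : ∀ (p : M) (v w : TangentSpace 𝓘(ℂ, CSpace n) p),
    starRingEnd ℂ (form p v w) = form p w v
  pos : ∀ (p : M) (v : TangentSpace 𝓘(ℂ, CSpace n) p), v ≠ 0 → 0 < (form p v v).re
  smooth : ∀ e ∈ atlas (CSpace n) M, ∀ i j : Fin n,
    ContDiffOn ℝ ∞ (fun z : CSpace n => form (e.symm z)
      (mfderiv 𝓘(ℂ, CSpace n) 𝓘(ℂ, CSpace n) e.symm z (EuclideanSpace.single i (1 : ℂ)))
      (mfderiv 𝓘(ℂ, CSpace n) 𝓘(ℂ, CSpace n) e.symm z (EuclideanSpace.single j (1 : ℂ))))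
      e.target

variable {n : ℕ} {M : Type*} [TopologicalSpace M] [ChartedSpace (CSpace n) M]

/-- The matrix `(g_{i j̄})` of the metric in the chart `e`, as a function of the coordinates. -/
def HermitianMetric.coeff (g : HermitianMetric n M) (e : OpenPartialHomeomorph M (CSpace n))
    (z : CSpace n) : Matrix (Fin n) (Fin n) ℂ :=
  Matrix.of fun i j => g.form (e.symm z)
    (mfderiv 𝓘(ℂ, CSpace n) 𝓘(ℂ, CSpace n) e.symm z (EuclideanSpace.single i (1 : ℂ)))
    (mfderiv 𝓘(ℂ, CSpace n) 𝓘(ℂ, CSpace n) e.symm z (EuclideanSpace.single j (1 : ℂ)))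

/-- The matrix `(∂_i ∂_{j̄} φ)` of the real function `φ` in the chart `e`. -/
def complexHessian (φ : M → ℝ) (e : OpenPartialHomeomorph M (CSpace n)) (z : CSpace n) :
    Matrix (Fin n) (Fin n) ℂ :=
  Matrix.of fun i j => dz i (dzbar j fun x => (φ (e.symm x) : ℂ)) z

/-- The matrix `g'_{i j̄} = g_{i j̄} + ∂_i ∂_{j̄} φ` in the chart `e`. -/
def HermitianMetric.deformedCoeff (g : HermitianMetric n M) (φ : M → ℝ)
    (e : OpenPartialHomeomorph M (CSpace n)) (z : CSpace n) : Matrix (Fin n) (Fin n) ℂ :=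
  g.coeff e z + complexHessian φ e z

/-- `ω + √-1 ∂∂̄φ > 0`: the matrix `(g'_{i j̄})` is positive definite at every point of every
chart of the atlas. -/
def HermitianMetric.IsAdmissible (g : HermitianMetric n M) (φ : M → ℝ) : Prop :=
  ∀ e ∈ atlas (CSpace n) M, ∀ z ∈ e.target, (g.deformedCoeff φ e z).PosDef

/-- The trace `tr_g g' = g^{i j̄} g'_{i j̄}` at `p`, a real number that does not depend on the
holomorphic chart around `p` in which it is computed. -/
def HermitianMetric.traceDeformed (g : HermitianMetric n M) (φ : M → ℝ) (p : M) : ℝ :=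
  (((g.coeff (chartAt (CSpace n) p) (chartAt (CSpace n) p p))⁻¹ *
    g.deformedCoeff φ (chartAt (CSpace n) p) (chartAt (CSpace n) p p)).trace).re

/-- The measure `ωⁿ` on the domain of one chart `e`, extended by zero to `M`. In coordinates, with
`ω = √-1 ∑ g_{i j̄} dzⁱ ∧ dz̄ʲ`, one has `ωⁿ = n! 2ⁿ det(g_{i j̄}) dx¹ dy¹ ⋯ dxⁿ dyⁿ`. -/
def HermitianMetric.localVolume [MeasurableSpace M] (g : HermitianMetric n M)
    (e : OpenPartialHomeomorph M (CSpace n)) : Measure M :=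
  (((volume : Measure (CSpace n)).restrict e.target).withDensity fun z =>
    ENNReal.ofReal ((n.factorial : ℝ) * 2 ^ n * (g.coeff e z).det.re)).map e.symm

/-- The measure `ωⁿ` on `M`. The local measures agree on overlaps of charts, so the global measure
they determine is their supremum in the lattice of measures. -/
def HermitianMetric.volumeMeasure [MeasurableSpace M] (g : HermitianMetric n M) : Measure M :=
  ⨆ e ∈ atlas (CSpace n) M, g.localVolume e

/-- The normalized measure `dμ = ωⁿ / ∫_M ωⁿ`. -/
def HermitianMetric.normalizedVolume [MeasurableSpace M] (g : HermitianMetric n M) : Measure M :=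
  (g.volumeMeasure Set.univ)⁻¹ • g.volumeMeasure

end HermitianGeometry

end

/-! Put `m = inf φ` and `u = e^{-q(φ-m)}` with `q = max α A`, so that `0 < u ≤ 1`, with `u = 1`
where `φ` attains its minimum. Since `g' > 0`, it is bounded by `(tr_g g') g`
(`quadratic_le_trace_mul`), hence `∂∂̄φ ≤ (tr_g g' - 1) g`. Differentiating the exponential produces
`-q u ∂∂̄φ` plus a nonnegative square of the gradient. The second-order estimate therefore bounds
the Hessian of `u` from below by a multiple of `-q |C| e^{(A-q)(φ-m)} g`, and `q ≥ A` makes the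
exponential at most 1. So in each fixed coordinate ball the flat Laplacian of `u` is at least `-K`,
with `K` independent of `φ` (`sum_leviForm_exp_ge`).

A function with Laplacian at least `-K` satisfies a sub-mean-value inequality with error of order `K
r²` (`mul_integral_ballWeight_le`). On a ball of small fixed radius about the minimum point this
keeps the integral of `u` away from zero. As `α ≤ q`, the same lower bound holds for `∫ e^{-α(φ-m)}
ωⁿ`. Compactness of `M` makes the bound uniform in the position of the minimum
(`exists_lower_bound`). Factoring out `e^{-αm}`, normalizing and taking logarithms gives the claim.
-/

namespace HermitianGeometry

/-! ### Weighted sub-mean-value inequality in Euclidean space. -/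

section SubMeanValue

theorem hasDerivAt_max_zero_sq (s : ℝ) :
    HasDerivAt (fun x : ℝ => max x 0 ^ 2) (2 * max s 0) s := by
  rcases lt_trichotomy s 0 with h | h | h
  · have : (fun x : ℝ => max x 0 ^ 2) =ᶠ[nhds s] fun _ => 0 := by
      filter_upwards [Iio_mem_nhds h] with x hx
      simp [max_eq_right (le_of_lt (Set.mem_Iio.1 hx))]
    rw [max_eq_right h.le, mul_zero]
    exact (hasDerivAt_const s (0 : ℝ)).congr_of_eventuallyEq this
  · subst h
    rw [hasDerivAt_iff_isLittleO]
    have h2 : (fun x : ℝ => x ^ 2) =o[nhds 0] fun x => x := by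
      simpa using Asymptotics.isLittleO_pow_pow (𝕜 := ℝ) (m := 1) (n := 2) (by norm_num)
    simp only [max_self, mul_zero, smul_zero, sub_zero]
    refine Asymptotics.IsBigO.trans_isLittleO ?_ h2
    refine Asymptotics.IsBigO.of_bound 1 (Filter.Eventually.of_forall fun x => ?_)
    rcases le_total x 0 with hx | hx
    · simp [max_eq_right hx]; positivity
    · simp [max_eq_left hx]
  · have : (fun x : ℝ => max x 0 ^ 2) =ᶠ[nhds s] fun x => x ^ 2 := by
      filter_upwards [Ioi_mem_nhds h] with x hx
      simp [max_eq_left (le_of_lt (Set.mem_Ioi.1 hx))]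
    rw [max_eq_left h.le]
    simpa using (hasDerivAt_pow 2 s).congr_of_eventuallyEq this

variable {E : Type*} [NormedAddCommGroup E]

/-- The radial weight `(1 - ‖w‖²)₊` on the unit ball. -/
noncomputable def ballWeight (w : E) : ℝ := max (1 - ‖w‖ ^ 2) 0

/-- A potential of the field `-ballWeight w • w`, supported in the unit ball. -/
noncomputable def ballPotential (w : E) : ℝ := max (1 - ‖w‖ ^ 2) 0 ^ 2 / 4

theorem continuous_ballWeight : Continuous (ballWeight : E → ℝ) := by
  unfold ballWeight; fun_prop

theorem continuous_ballPotential : Continuous (ballPotential : E → ℝ) := by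
  unfold ballPotential; fun_prop

theorem ballWeight_nonneg (w : E) : 0 ≤ ballWeight w := le_max_right _ _

theorem ballPotential_nonneg (w : E) : 0 ≤ ballPotential w := by
  unfold ballPotential; positivity

theorem ballWeight_le_one (w : E) : ballWeight w ≤ 1 :=
  max_le (by linarith [sq_nonneg ‖w‖]) zero_le_one

theorem ballPotential_eq (w : E) : ballPotential w = ballWeight w ^ 2 / 4 := rfl

theorem ballWeight_eq_zero {w : E} (hw : 1 ≤ ‖w‖) : ballWeight w = 0 :=
  max_eq_right (by nlinarith)

theorem ballPotential_eq_zero {w : E} (hw : 1 ≤ ‖w‖) : ballPotential w = 0 := by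
  simp [ballPotential_eq, ballWeight_eq_zero hw]

variable [InnerProductSpace ℝ E]

theorem hasCompactSupport_ballWeight [FiniteDimensional ℝ E] :
    HasCompactSupport (ballWeight : E → ℝ) := by
  have : ProperSpace E := FiniteDimensional.proper_real E
  refine HasCompactSupport.intro (isCompact_closedBall (0 : E) 1) fun w hw => ?_
  exact ballWeight_eq_zero (by simpa using (not_le.1 (by simpa using hw)).le)

theorem hasCompactSupport_ballPotential [FiniteDimensional ℝ E] :
    HasCompactSupport (ballPotential : E → ℝ) := by
  have : ProperSpace E := FiniteDimensional.proper_real E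
  refine HasCompactSupport.intro (isCompact_closedBall (0 : E) 1) fun w hw => ?_
  exact ballPotential_eq_zero (by simpa using (not_le.1 (by simpa using hw)).le)

/-- Squaring the positive part removes the corner at the unit sphere, so the formula holds
everywhere and integration by parts needs no boundary term. -/
theorem hasFDerivAt_ballPotential (w : E) :
    HasFDerivAt (ballPotential : E → ℝ) (-(ballWeight w • innerSL ℝ w)) w := by
  have h1 : HasFDerivAt (fun x : E => 1 - ‖x‖ ^ 2) (-(2 • innerSL ℝ w)) w :=
    (hasStrictFDerivAt_norm_sq w).hasFDerivAt.const_sub 1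
  have h2 := ((hasDerivAt_max_zero_sq (1 - ‖w‖ ^ 2)).comp_hasFDerivAt w h1).mul_const (1 / 4)
  refine (h2.congr_fderiv ?_).congr_of_eventuallyEq (Filter.Eventually.of_forall fun x => ?_)
  · ext x; simp [ballWeight]; ring
  · simp [ballPotential]; ring

variable [FiniteDimensional ℝ E] [MeasurableSpace E] [BorelSpace E]
  {μ : Measure E} [μ.IsAddHaarMeasure]

theorem integrable_ballWeight_mul {f : E → ℝ} (hf : Continuous f) :
    Integrable (fun w => ballWeight w * f w) μ :=
  (continuous_ballWeight.mul hf).integrable_of_hasCompactSupport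
    hasCompactSupport_ballWeight.mul_right

theorem integrable_ballPotential_mul {f : E → ℝ} (hf : Continuous f) :
    Integrable (fun w => ballPotential w * f w) μ :=
  (continuous_ballPotential.mul hf).integrable_of_hasCompactSupport
    hasCompactSupport_ballPotential.mul_right

theorem integral_ballWeight_pos : 0 < ∫ w : E, ballWeight w ∂μ := by
  refine Continuous.integral_pos_of_hasCompactSupport_nonneg_nonzero (x := 0)
    continuous_ballWeight hasCompactSupport_ballWeight ballWeight_nonneg ?_
  simp [ballWeight]

theorem hasDerivAt_integral_ballWeight_mul {u : E → ℝ} (hu : ContDiff ℝ 1 u) (x₀ : E) (t₀ : ℝ) :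
    HasDerivAt (fun t : ℝ => ∫ w, ballWeight w * u (x₀ + t • w) ∂μ)
      (∫ w, ballWeight w * fderiv ℝ u (x₀ + t₀ • w) w ∂μ) t₀ := by
  have : ProperSpace E := FiniteDimensional.proper_real E
  have hu' : Continuous (fderiv ℝ u) := hu.continuous_fderiv one_ne_zero
  obtain ⟨B, hB⟩ := (isCompact_closedBall x₀ (|t₀| + 1)).exists_bound_of_continuousOn
    hu'.continuousOn
  have hbound : ∀ w : E, ∀ t ∈ Metric.ball t₀ 1,
      ‖ballWeight w * fderiv ℝ u (x₀ + t • w) w‖ ≤ B * ballWeight w := by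
    intro w t ht
    by_cases hw : 1 ≤ ‖w‖
    · simp [ballWeight_eq_zero hw]
    · push Not at hw
      have ht' : |t| ≤ |t₀| + 1 := by
        rw [Metric.mem_ball, Real.dist_eq] at ht
        have := abs_sub_abs_le_abs_sub t t₀
        linarith
      have hmem : x₀ + t • w ∈ Metric.closedBall x₀ (|t₀| + 1) := by
        rw [Metric.mem_closedBall, dist_eq_norm, add_sub_cancel_left, norm_smul, Real.norm_eq_abs]
        nlinarith [abs_nonneg t, norm_nonneg w]
      have h1 := hB _ hmem
      have h2 : ‖fderiv ℝ u (x₀ + t • w) w‖ ≤ B := by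
        refine (ContinuousLinearMap.le_opNorm _ _).trans ?_
        nlinarith [norm_nonneg (fderiv ℝ u (x₀ + t • w)), norm_nonneg w]
      rw [norm_mul, Real.norm_of_nonneg (ballWeight_nonneg w), mul_comm]
      exact mul_le_mul_of_nonneg_right h2 (ballWeight_nonneg w)
  refine (hasDerivAt_integral_of_dominated_loc_of_deriv_le (Metric.ball_mem_nhds t₀ one_pos)
    (F := fun t w => ballWeight w * u (x₀ + t • w))
    (F' := fun t w => ballWeight w * fderiv ℝ u (x₀ + t • w) w)
    (bound := fun w => B * ballWeight w) ?_ ?_ ?_ ?_ ?_ ?_).2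
  · refine Filter.Eventually.of_forall fun t => ?_
    exact (integrable_ballWeight_mul (by have := hu.continuous; fun_prop)).aestronglyMeasurable
  · exact integrable_ballWeight_mul (by have := hu.continuous; fun_prop)
  · exact (integrable_ballWeight_mul (by fun_prop)).aestronglyMeasurable
  · exact Filter.Eventually.of_forall hbound
  · exact (continuous_ballWeight.integrable_of_hasCompactSupport
      hasCompactSupport_ballWeight).const_mul B
  · refine Filter.Eventually.of_forall fun w t _ => ?_
    have h1 : HasDerivAt (fun s : ℝ => x₀ + s • w) w t := by
      simpa using ((hasDerivAt_id t).smul_const w).const_add x₀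
    exact (((hu.differentiable one_ne_zero _).hasFDerivAt).comp_hasDerivAt t h1).const_mul _

/-- The field `ballWeight w • w` is minus the gradient of `ballPotential`. Integrating by parts in
each frame direction moves the derivative onto `∇u(x₀ + t w)`, and the chain rule supplies the
factor `t`. -/
theorem integral_ballWeight_mul_fderiv {ι : Type*} [Fintype ι] {b : ι → E}
    (hb : ∀ w : E, ∑ k, inner ℝ w (b k) • b k = w) {u : E → ℝ} (hu : ContDiff ℝ 2 u) (x₀ : E)
    (t : ℝ) :
    ∫ w, ballWeight w * fderiv ℝ u (x₀ + t • w) w ∂μ =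
      t * ∫ w, ballPotential w *
        ∑ k, fderiv ℝ (fun y => fderiv ℝ u y (b k)) (x₀ + t • w) (b k) ∂μ := by
  have hu1 : ContDiff ℝ 1 (fderiv ℝ u) := hu.fderiv_right (by norm_num)
  have hG : ∀ v, ContDiff ℝ 1 (fun y => fderiv ℝ u y v) := fun v => hu1.clm_apply contDiff_const
  have hGc : ∀ v, Continuous (fun w => fderiv ℝ u (x₀ + t • w) v) := fun v => by
    have := (hG v).continuous; fun_prop
  have hGd : ∀ v w, HasFDerivAt (fun w => fderiv ℝ u (x₀ + t • w) v)
      (t • fderiv ℝ (fun y => fderiv ℝ u y v) (x₀ + t • w)) w := by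
    intro v w
    have h1 : HasFDerivAt (fun w : E => x₀ + t • w) (t • ContinuousLinearMap.id ℝ E) w :=
      ((hasFDerivAt_id w).const_smul t).const_add x₀
    have h2 := (((hG v).differentiable one_ne_zero (x₀ + t • w)).hasFDerivAt).comp w h1
    refine h2.congr_fderiv ?_
    ext x; simp
  have hG'c : ∀ v, Continuous (fun w => fderiv ℝ (fun y => fderiv ℝ u y v) (x₀ + t • w) v) := by
    intro v
    have := (hG v).continuous_fderiv one_ne_zero
    fun_prop
  have hparts : ∀ k, ∫ w, ballWeight w * (inner ℝ w (b k) * fderiv ℝ u (x₀ + t • w) (b k)) ∂μ =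
      ∫ w, ballPotential w *
        (t * fderiv ℝ (fun y => fderiv ℝ u y (b k)) (x₀ + t • w) (b k)) ∂μ := by
    intro k
    have hi : Continuous fun w : E => (inner ℝ w (b k) : ℝ) := by fun_prop
    have e1 : ∀ w : E, fderiv ℝ ballPotential w (b k) * fderiv ℝ u (x₀ + t • w) (b k) =
        -(ballWeight w * (inner ℝ w (b k) * fderiv ℝ u (x₀ + t • w) (b k))) := by
      intro w
      rw [(hasFDerivAt_ballPotential w).fderiv]
      simp
      ring
    have e2 : ∀ w : E, fderiv ℝ (fun w => fderiv ℝ u (x₀ + t • w) (b k)) w (b k) =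
        t * fderiv ℝ (fun y => fderiv ℝ u y (b k)) (x₀ + t • w) (b k) := by
      intro w
      rw [(hGd (b k) w).fderiv]
      simp
    have key := integral_mul_fderiv_eq_neg_fderiv_mul_of_integrable (μ := μ)
      (f := (ballPotential : E → ℝ)) (g := fun w => fderiv ℝ u (x₀ + t • w) (b k)) (v := b k)
      ?_ ?_ ?_ (fun x _ => (hasFDerivAt_ballPotential x).differentiableAt)
      (fun x _ => (hGd (b k) x).differentiableAt)
    · simp_rw [e1, e2] at key
      rw [key, integral_neg, neg_neg]
    · simp_rw [e1]
      exact (integrable_ballWeight_mul (hi.mul (hGc _))).neg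
    · simp_rw [e2]
      exact integrable_ballPotential_mul ((hG'c _).const_mul t)
    · exact integrable_ballPotential_mul (hGc _)
  calc ∫ w, ballWeight w * fderiv ℝ u (x₀ + t • w) w ∂μ
      = ∫ w, ∑ k, ballWeight w * (inner ℝ w (b k) * fderiv ℝ u (x₀ + t • w) (b k)) ∂μ := by
        congr 1 with w
        rw [← Finset.mul_sum]
        congr 1
        -- Expanding `w` also affects the base point `x₀ + t • w`; the last rewrite folds it back
        -- there.
        conv_lhs => rw [← hb w, map_sum, hb w]
        simp
    _ = ∑ k, ∫ w, ballPotential w *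
        (t * fderiv ℝ (fun y => fderiv ℝ u y (b k)) (x₀ + t • w) (b k)) ∂μ := by
        rw [integral_finsetSum]
        · exact Finset.sum_congr rfl fun k _ => hparts k
        · intro k _
          exact integrable_ballWeight_mul ((by fun_prop : Continuous fun w : E =>
            (inner ℝ w (b k) : ℝ)).mul (hGc _))
    _ = _ := by
        rw [← integral_finsetSum, ← integral_const_mul]
        · congr 1 with w
          rw [← Finset.mul_sum, ← Finset.mul_sum]
          ring
        · intro k _
          exact integrable_ballPotential_mul ((hG'c _).const_mul t)

/-- The sub-mean-value inequality for a `C²` function whose Laplacian, computed in the tight frame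
`b`, is bounded below by `-K`. -/
theorem mul_integral_ballWeight_le {ι : Type*} [Fintype ι] {b : ι → E}
    (hb : ∀ w : E, ∑ k, inner ℝ w (b k) • b k = w) {u : E → ℝ} (hu : ContDiff ℝ 2 u) {x₀ : E}
    {r K : ℝ} (hr : 0 < r)
    (hK : ∀ z ∈ Metric.ball x₀ r, -K ≤ ∑ k, fderiv ℝ (fun y => fderiv ℝ u y (b k)) z (b k)) :
    u x₀ * ∫ w, ballWeight w ∂μ ≤
      ∫ w, ballWeight w * u (x₀ + r • w) ∂μ + K * (∫ w : E, ballPotential w ∂μ) * r ^ 2 / 2 := by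
  set P := ∫ w : E, ballPotential w ∂μ with hP
  -- The weighted average at scale `t` has derivative `t ∫ ballPotential · Δu ≥ -K P t`. Adding `K P
  -- t² / 2` makes it nondecreasing, and comparing `t = 0` with `t = r` gives the inequality.
  have hd : ∀ t : ℝ, HasDerivAt
      (fun t : ℝ => ∫ w, ballWeight w * u (x₀ + t • w) ∂μ + K * P * t ^ 2 / 2)
      (∫ w, ballWeight w * fderiv ℝ u (x₀ + t • w) w ∂μ + K * P * t) t := by
    intro t
    have h2 : HasDerivAt (fun t : ℝ => K * P * t ^ 2 / 2) (K * P * t) t := by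
      have := ((hasDerivAt_pow 2 t).const_mul (K * P)).div_const 2
      refine this.congr_deriv ?_
      push_cast; ring
    exact (hasDerivAt_integral_ballWeight_mul (hu.of_le (by norm_num)) x₀ t).add h2
  have hmono : MonotoneOn
      (fun t : ℝ => ∫ w, ballWeight w * u (x₀ + t • w) ∂μ + K * P * t ^ 2 / 2) (Set.Icc 0 r) := by
    refine monotoneOn_of_deriv_nonneg (convex_Icc 0 r)
      (fun t _ => (hd t).continuousAt.continuousWithinAt)
      (fun t _ => (hd t).differentiableAt.differentiableWithinAt) fun t ht => ?_
    rw [interior_Icc] at ht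
    rw [(hd t).deriv, integral_ballWeight_mul_fderiv hb hu, ← mul_comm t, ← mul_add]
    refine mul_nonneg ht.1.le ?_
    have hu1 : ContDiff ℝ 1 (fderiv ℝ u) := hu.fderiv_right (by norm_num)
    have hc : Continuous fun w : E =>
        ∑ k, fderiv ℝ (fun y => fderiv ℝ u y (b k)) (x₀ + t • w) (b k) := by
      refine continuous_finsetSum _ fun k _ => ?_
      have := (hu1.clm_apply (contDiff_const (c := b k))).continuous_fderiv one_ne_zero
      fun_prop
    have hle : ∫ w : E, ballPotential w * (-K) ∂μ ≤ ∫ w, ballPotential w *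
        ∑ k, fderiv ℝ (fun y => fderiv ℝ u y (b k)) (x₀ + t • w) (b k) ∂μ := by
      refine integral_mono (integrable_ballPotential_mul continuous_const)
        (integrable_ballPotential_mul hc) fun w => ?_
      by_cases hw : 1 ≤ ‖w‖
      · simp [ballPotential_eq_zero hw]
      · refine mul_le_mul_of_nonneg_left (hK _ ?_) (ballPotential_nonneg w)
        push Not at hw
        rw [Metric.mem_ball, dist_eq_norm, add_sub_cancel_left, norm_smul,
          Real.norm_of_nonneg ht.1.le]
        nlinarith [ht.1, ht.2, norm_nonneg w]
    rw [integral_mul_const] at hle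
    linarith
  have h := hmono (Set.left_mem_Icc.2 hr.le) (Set.right_mem_Icc.2 hr.le) hr.le
  simp only [zero_smul, add_zero, integral_mul_const] at h
  norm_num at h
  linarith

end SubMeanValue

/-! ### Comparison of positive Hermitian forms through the trace. -/

section LinearAlgebra

open Matrix

theorem star_dotProduct_self_eq {m : Type*} [Fintype m] (y : m → ℂ) :
    star y ⬝ᵥ y = ((∑ i, ‖y i‖ ^ 2 : ℝ) : ℂ) := by
  simp only [dotProduct, Pi.star_apply, RCLike.star_def, Complex.ofReal_sum]
  refine Finset.sum_congr rfl fun i _ => ?_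
  rw [← Complex.normSq_eq_conj_mul_self, Complex.normSq_eq_norm_sq]

theorem star_dotProduct_conjTranspose_mul_self {m : Type*} [Fintype m] (B : Matrix m m ℂ)
    (x : m → ℂ) : star x ⬝ᵥ (Bᴴ * B) *ᵥ x = ((∑ i, ‖(B *ᵥ x) i‖ ^ 2 : ℝ) : ℂ) := by
  rw [← star_dotProduct_self_eq, star_mulVec, ← mulVec_mulVec, dotProduct_mulVec]

theorem trace_conjTranspose_mul_self_eq {m : Type*} [Fintype m] (B : Matrix m m ℂ) :
    (Bᴴ * B).trace = ((∑ j, ∑ i, ‖B i j‖ ^ 2 : ℝ) : ℂ) := by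
  simp only [trace, diag, mul_apply, conjTranspose_apply, RCLike.star_def, Complex.ofReal_sum]
  refine Finset.sum_congr rfl fun i _ => Finset.sum_congr rfl fun j _ => ?_
  rw [← Complex.normSq_eq_conj_mul_self, Complex.normSq_eq_norm_sq]

/-- Cauchy–Schwarz in each row: the Hilbert–Schmidt norm dominates the operator norm. -/
theorem sum_norm_mulVec_sq_le {m : Type*} [Fintype m] (B : Matrix m m ℂ) (y : m → ℂ) :
    ∑ i, ‖(B *ᵥ y) i‖ ^ 2 ≤ (∑ j, ∑ i, ‖B i j‖ ^ 2) * ∑ i, ‖y i‖ ^ 2 := by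
  rw [Finset.sum_comm, Finset.sum_mul]
  refine Finset.sum_le_sum fun i _ => ?_
  have h1 : ‖(B *ᵥ y) i‖ ≤ ∑ j, ‖B i j‖ * ‖y j‖ := by
    simp only [mulVec, dotProduct]
    exact (norm_sum_le _ _).trans_eq (Finset.sum_congr rfl fun j _ => norm_mul _ _)
  calc ‖(B *ᵥ y) i‖ ^ 2 ≤ (∑ j, ‖B i j‖ * ‖y j‖) ^ 2 := by gcongr
    _ ≤ _ := Finset.sum_mul_sq_le_sq_mul_sq _ _ _

open scoped MatrixOrder in
/-- A positive form `G'` is bounded by `tr(G⁻¹G') • G`. -/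
theorem quadratic_le_trace_mul {m : Type*} [Fintype m] [DecidableEq m] {G G' : Matrix m m ℂ}
    (hG : G.PosDef) (hG' : G'.PosSemidef) (x : m → ℂ) :
    (star x ⬝ᵥ G' *ᵥ x).re ≤ (G⁻¹ * G').trace.re * (star x ⬝ᵥ G *ᵥ x).re := by
  have hunit := hG.isUnit
  -- With `G = B*B`, `G' = D*D` and `E = D B⁻¹`, the trace of `G⁻¹G'` is the squared Hilbert–Schmidt
  -- norm of `E`, while `x*G'x = ‖E(Bx)‖²` and `x*Gx = ‖Bx‖²`.
  obtain ⟨B, hB⟩ := CStarAlgebra.nonneg_iff_eq_star_mul_self.mp hG.posSemidef.nonneg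
  obtain ⟨D, hD⟩ := CStarAlgebra.nonneg_iff_eq_star_mul_self.mp hG'.nonneg
  rw [star_eq_conjTranspose] at hB hD
  have hBu : IsUnit B.det := by
    rw [isUnit_iff_isUnit_det, hB, det_mul] at hunit
    exact isUnit_of_mul_isUnit_right hunit
  have hDB : D = (D * B⁻¹) * B := by rw [Matrix.mul_assoc, nonsing_inv_mul _ hBu, Matrix.mul_one]
  have htr : (G⁻¹ * G').trace = ((D * B⁻¹)ᴴ * (D * B⁻¹)).trace := by
    rw [hB, hD, Matrix.mul_inv_rev, conjTranspose_mul, conjTranspose_nonsing_inv, Matrix.mul_assoc,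
      trace_mul_comm]
    simp only [Matrix.mul_assoc]
  rw [htr, trace_conjTranspose_mul_self_eq, hB, hD, star_dotProduct_conjTranspose_mul_self,
    star_dotProduct_conjTranspose_mul_self, Complex.ofReal_re, Complex.ofReal_re, Complex.ofReal_re]
  have h := sum_norm_mulVec_sq_le (D * B⁻¹) (B *ᵥ x)
  rwa [mulVec_mulVec, ← hDB] at h

end LinearAlgebra

/-! ### The complex Hessian as a real quadratic form. -/

section LeviForm

variable {n : ℕ}

/-- The real Hessian `D²f(v, v) + D²f(√-1 v, √-1 v)`, four times the complex Hessian. -/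
noncomputable def leviForm (f : CSpace n → ℝ) (z v : CSpace n) : ℝ :=
  fderiv ℝ (fderiv ℝ f) z v v + fderiv ℝ (fderiv ℝ f) z (Complex.I • v) (Complex.I • v)

theorem fderiv_fderiv_apply {E F : Type*} [NormedAddCommGroup E] [NormedSpace ℝ E]
    [NormedAddCommGroup F] [NormedSpace ℝ F] {f : E → F} {z : E}
    (hf : ContDiffAt ℝ 2 f z) (v a : E) :
    fderiv ℝ (fun y => fderiv ℝ f y v) z a = fderiv ℝ (fderiv ℝ f) z a v := by
  have h : DifferentiableAt ℝ (fderiv ℝ f) z :=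
    (hf.fderiv_right (m := 1) (by norm_num)).differentiableAt one_ne_zero
  rw [(h.hasFDerivAt.clm_apply (hasFDerivAt_const v z)).fderiv]
  simp

theorem single_I (i : Fin n) : (EuclideanSpace.single i Complex.I : CSpace n) =
    Complex.I • EuclideanSpace.single i 1 := by
  ext j; by_cases h : j = i <;> simp [h]

theorem eventually_differentiableAt {E F : Type*} [NormedAddCommGroup E] [NormedSpace ℝ E]
    [NormedAddCommGroup F] [NormedSpace ℝ F] {f : E → F} {z : E}
    (hf : ContDiffAt ℝ 2 f z) : ∀ᶠ y in nhds z, DifferentiableAt ℝ f y := by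
  filter_upwards [hf.eventually (by simp)] with y hy
  exact hy.differentiableAt two_ne_zero

theorem fderiv_ofReal_comp {f : CSpace n → ℝ} {y : CSpace n} (hf : DifferentiableAt ℝ f y)
    (v : CSpace n) : fderiv ℝ (fun x => (f x : ℂ)) y v = (fderiv ℝ f y v : ℂ) := by
  have := (Complex.ofRealCLM.hasFDerivAt (x := f y)).comp y hf.hasFDerivAt
  have h2 : HasFDerivAt (fun x => (f x : ℂ)) (Complex.ofRealCLM.comp (fderiv ℝ f y)) y := this
  rw [h2.fderiv]
  simp

theorem dz_dzbar_ofReal {f : CSpace n → ℝ} {z : CSpace n} (hf : ContDiffAt ℝ 2 f z)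
    (i j : Fin n) :
    dz i (dzbar j fun x => (f x : ℂ)) z =
      (fderiv ℝ (fderiv ℝ f) z (EuclideanSpace.single i 1) (EuclideanSpace.single j 1)
      + fderiv ℝ (fderiv ℝ f) z (Complex.I • EuclideanSpace.single i 1)
          (Complex.I • EuclideanSpace.single j 1)
      + Complex.I * (fderiv ℝ (fderiv ℝ f) z (EuclideanSpace.single i 1)
          (Complex.I • EuclideanSpace.single j 1)
        - fderiv ℝ (fderiv ℝ f) z (Complex.I • EuclideanSpace.single i 1)
          (EuclideanSpace.single j 1))) / 4 := by
  have hd : DifferentiableAt ℝ (fderiv ℝ f) z :=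
    (hf.fderiv_right (m := 1) (by norm_num)).differentiableAt one_ne_zero
  have hv : ∀ v : CSpace n, HasFDerivAt (fun y => ((fderiv ℝ f y v : ℝ) : ℂ))
      (Complex.ofRealCLM.comp ((fderiv ℝ (fderiv ℝ f) z).flip v)) z := by
    intro v
    have h1 := hd.hasFDerivAt.clm_apply (hasFDerivAt_const v z)
    have h2 := (Complex.ofRealCLM.hasFDerivAt (x := fderiv ℝ f z v)).comp z h1
    refine h2.congr_fderiv ?_
    ext a; simp
  have he : (dzbar j fun x => (f x : ℂ)) =ᶠ[nhds z] fun y =>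
      (((fderiv ℝ f y (EuclideanSpace.single j 1) : ℝ) : ℂ) + Complex.I *
        ((fderiv ℝ f y (Complex.I • EuclideanSpace.single j 1) : ℝ) : ℂ)) * (1 / 2) := by
    filter_upwards [eventually_differentiableAt hf] with y hy
    simp only [dzbar, fderiv_ofReal_comp hy, single_I]
    ring
  have hD := ((hv (EuclideanSpace.single j 1)).add
    ((hv (Complex.I • EuclideanSpace.single j 1)).const_mul Complex.I)).mul_const (1 / 2 : ℂ)
  have hD' := (hD.congr_of_eventuallyEq he).fderiv
  simp only [dz, hD', single_I]
  simp
  linear_combination (-(1 : ℂ) / 4 * (fderiv ℝ (fderiv ℝ f) z (Complex.I • EuclideanSpace.single i 1)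
          (Complex.I • EuclideanSpace.single j 1) : ℂ)) * Complex.I_sq

/-- The sesquilinear form with the same diagonal as the Hermitian part of a real bilinear form. -/
noncomputable def hermitize (D : CSpace n →L[ℝ] CSpace n →L[ℝ] ℝ) (v w : CSpace n) : ℂ :=
  (D v w + D (Complex.I • v) (Complex.I • w)
    + Complex.I * (D v (Complex.I • w) - D (Complex.I • v) w)) / 4

theorem smul_eq_re_add_im (c : ℂ) (v : CSpace n) :
    c • v = c.re • v + c.im • (Complex.I • v) := by
  ext i
  simp only [PiLp.smul_apply, PiLp.add_apply, smul_eq_mul, Complex.real_smul]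
  conv_lhs => rw [← Complex.re_add_im c]
  ring

theorem I_smul_I_smul (v : CSpace n) : Complex.I • Complex.I • v = -v := by
  rw [smul_smul, Complex.I_mul_I, neg_one_smul]

theorem hermitize_smul_left (D : CSpace n →L[ℝ] CSpace n →L[ℝ] ℝ) (c : ℂ) (v w : CSpace n) :
    hermitize D (c • v) w = c * hermitize D v w := by
  have h2 : Complex.I • c • v = c.re • (Complex.I • v) - c.im • v := by
    rw [smul_comm, smul_eq_re_add_im c (Complex.I • v), I_smul_I_smul, smul_neg, sub_eq_add_neg]
  have hI := Complex.I_sq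
  unfold hermitize
  rw [h2, smul_eq_re_add_im c v]
  simp only [map_add, map_sub, map_smul, _root_.add_apply,
    _root_.sub_apply, _root_.smul_apply, smul_eq_mul]
  push_cast
  conv_rhs => rw [← Complex.re_add_im c]
  generalize (D v w : ℂ) = a1
  generalize ((D (Complex.I • v) w : ℝ) : ℂ) = a2
  generalize ((D v (Complex.I • w) : ℝ) : ℂ) = a3
  generalize ((D (Complex.I • v) (Complex.I • w) : ℝ) : ℂ) = a4
  linear_combination (-(c.im : ℂ) * (a3 - a2) / 4) * hI

theorem hermitize_smul_right (D : CSpace n →L[ℝ] CSpace n →L[ℝ] ℝ) (c : ℂ) (v w : CSpace n) :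
    hermitize D v (c • w) = starRingEnd ℂ c * hermitize D v w := by
  have h2 : Complex.I • c • w = c.re • (Complex.I • w) - c.im • w := by
    rw [smul_comm, smul_eq_re_add_im c (Complex.I • w), I_smul_I_smul, smul_neg, sub_eq_add_neg]
  have hI := Complex.I_sq
  have hc : starRingEnd ℂ c = c.re - c.im * Complex.I := by
    apply Complex.ext <;> simp
  unfold hermitize
  rw [h2, smul_eq_re_add_im c w, hc]
  simp only [map_add, map_sub, map_smul, smul_eq_mul]
  push_cast
  generalize (D v w : ℂ) = a1
  generalize ((D (Complex.I • v) w : ℝ) : ℂ) = a2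
  generalize ((D v (Complex.I • w) : ℝ) : ℂ) = a3
  generalize ((D (Complex.I • v) (Complex.I • w) : ℝ) : ℂ) = a4
  linear_combination ((c.im : ℂ) * (a3 - a2) / 4) * hI

theorem hermitize_sum_left (D : CSpace n →L[ℝ] CSpace n →L[ℝ] ℝ) (v : Fin n → CSpace n)
    (w : CSpace n) : hermitize D (∑ i, v i) w = ∑ i, hermitize D (v i) w := by
  unfold hermitize
  simp only [Finset.smul_sum, map_sum, _root_.sum_apply, Complex.ofReal_sum]
  rw [← Finset.sum_sub_distrib, Finset.mul_sum, ← Finset.sum_add_distrib, ← Finset.sum_add_distrib,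
    Finset.sum_div]

theorem hermitize_sum_right (D : CSpace n →L[ℝ] CSpace n →L[ℝ] ℝ) (v : CSpace n)
    (w : Fin n → CSpace n) : hermitize D v (∑ i, w i) = ∑ i, hermitize D v (w i) := by
  unfold hermitize
  simp only [Finset.smul_sum, map_sum, Complex.ofReal_sum]
  rw [← Finset.sum_sub_distrib, Finset.mul_sum, ← Finset.sum_add_distrib, ← Finset.sum_add_distrib,
    Finset.sum_div]

theorem sum_smul_single (v : CSpace n) :
    ∑ i, v i • (EuclideanSpace.single i 1 : CSpace n) = v := by
  ext j
  simp [Pi.single_apply]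

theorem sum_dz_dzbar_eq_leviForm {f : CSpace n → ℝ} {z : CSpace n} (hf : ContDiffAt ℝ 2 f z)
    (v : CSpace n) :
    ∑ i, ∑ j, v i * starRingEnd ℂ (v j) * dz i (dzbar j fun x => (f x : ℂ)) z =
      ((leviForm f z v / 4 : ℝ) : ℂ) := by
  -- Symmetry of the second derivative kills the imaginary part of `hermitize` on the diagonal. The
  -- rest is sesquilinear expansion in the standard basis.
  have hsymm := (hf.isSymmSndFDerivAt (by simp)) v (Complex.I • v)
  have h1 : ((leviForm f z v / 4 : ℝ) : ℂ) = hermitize (fderiv ℝ (fderiv ℝ f) z) v v := by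
    unfold hermitize leviForm
    rw [hsymm]
    push_cast
    ring
  rw [h1]
  conv_rhs => rw [← sum_smul_single v, hermitize_sum_left]
  refine Finset.sum_congr rfl fun i _ => ?_
  rw [hermitize_sum_right]
  refine Finset.sum_congr rfl fun j _ => ?_
  rw [hermitize_smul_left, hermitize_smul_right, dz_dzbar_ofReal hf, hermitize]
  ring

/-- The second-order chain rule leaves an extra term `Df(D²F(w, w))`. As `D²F` is complex bilinear,
its values at `v` and `√-1 v` are opposite and cancel. This is what makes the Levi form independent
of the holomorphic chart. -/
theorem leviForm_comp {f : CSpace n → ℝ} {F : CSpace n → CSpace n} {z : CSpace n}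
    (hF : ContDiffAt ℂ 2 F z) (hf : ContDiffAt ℝ 2 f (F z)) (v : CSpace n) :
    leviForm (fun x => f (F x)) z v = leviForm f (F z) (fderiv ℂ F z v) := by
  have hFR : ContDiffAt ℝ 2 F z := hF.restrict_scalars ℝ
  have hcomp : ContDiffAt ℝ 2 (fun x => f (F x)) z := hf.comp z hFR
  have hdF : DifferentiableAt ℂ (fderiv ℂ F) z :=
    (hF.fderiv_right (m := 1) (by norm_num)).differentiableAt one_ne_zero
  have hdf : DifferentiableAt ℝ (fderiv ℝ f) (F z) :=
    (hf.fderiv_right (m := 1) (by norm_num)).differentiableAt one_ne_zero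
  have hFz : HasFDerivAt F ((fderiv ℂ F z).restrictScalars ℝ) z :=
    (hF.differentiableAt two_ne_zero).hasFDerivAt.restrictScalars ℝ
  have key : ∀ w : CSpace n, fderiv ℝ (fderiv ℝ (fun x => f (F x))) z w w =
      fderiv ℝ (fderiv ℝ f) (F z) (fderiv ℂ F z w) (fderiv ℂ F z w) +
        fderiv ℝ f (F z) (fderiv ℂ (fderiv ℂ F) z w w) := by
    intro w
    rw [← fderiv_fderiv_apply hcomp]
    have he : (fun y => fderiv ℝ (fun x => f (F x)) y w) =ᶠ[nhds z]
        fun y => fderiv ℝ f (F y) (fderiv ℂ F y w) := by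
      filter_upwards [hF.eventually (by simp), hFR.continuousAt.eventually
        (eventually_differentiableAt hf)] with y hy hfy
      have h1 : HasFDerivAt F ((fderiv ℂ F y).restrictScalars ℝ) y :=
        (hy.differentiableAt two_ne_zero).hasFDerivAt.restrictScalars ℝ
      have h2 := hfy.hasFDerivAt.comp y h1
      have h3 : HasFDerivAt (fun x => f (F x))
        ((fderiv ℝ f (F y)).comp ((fderiv ℂ F y).restrictScalars ℝ)) y := h2
      rw [h3.fderiv]
      simp
    have hA := hdf.hasFDerivAt.comp z hFz
    have hB := (hdF.hasFDerivAt.clm_apply (hasFDerivAt_const w z)).restrictScalars ℝ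
    have hAB := (hA.clm_apply hB).congr_of_eventuallyEq he
    rw [hAB.fderiv]
    simp [add_comm]
  unfold leviForm
  rw [key, key]
  have hI : fderiv ℂ (fderiv ℂ F) z (Complex.I • v) (Complex.I • v) =
      -fderiv ℂ (fderiv ℂ F) z v v := by
    rw [map_smul, map_smul, _root_.smul_apply, smul_smul, Complex.I_mul_I,
      neg_one_smul]
  rw [hI, map_neg, map_smul]
  ring

/-- The discarded terms are `e^{-pf}` times the squares of `p Df(v)` and `p Df(√-1 v)`, so the sign
of `p` does not matter. -/
theorem leviForm_exp_neg_ge {f : CSpace n → ℝ} {z : CSpace n} (hf : ContDiffAt ℝ 2 f z)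
    (p : ℝ) (v : CSpace n) :
    -p * Real.exp (-p * f z) * leviForm f z v ≤
      leviForm (fun x => Real.exp (-p * f x)) z v := by
  have hcomp : ContDiffAt ℝ 2 (fun x => Real.exp (-p * f x)) z :=
    (contDiffAt_const.mul hf).exp
  have hdf : DifferentiableAt ℝ (fderiv ℝ f) z :=
    (hf.fderiv_right (m := 1) (by norm_num)).differentiableAt one_ne_zero
  have hexp : ∀ y, DifferentiableAt ℝ f y → HasFDerivAt (fun x => Real.exp (-p * f x))
      (Real.exp (-p * f y) • (-p • fderiv ℝ f y)) y := fun y hy =>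
    (hy.hasFDerivAt.const_mul (-p)).exp
  have key : ∀ w : CSpace n,
      fderiv ℝ (fderiv ℝ (fun x => Real.exp (-p * f x))) z w w =
      -p * Real.exp (-p * f z) * fderiv ℝ (fderiv ℝ f) z w w +
        Real.exp (-p * f z) * (p * fderiv ℝ f z w) ^ 2 := by
    intro w
    rw [← fderiv_fderiv_apply hcomp]
    have he : (fun y => fderiv ℝ (fun x => Real.exp (-p * f x)) y w) =ᶠ[nhds z]
        fun y => Real.exp (-p * f y) * (-p * fderiv ℝ f y w) := by
      filter_upwards [eventually_differentiableAt hf] with y hy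
      rw [(hexp y hy).fderiv]
      simp
    have hA := hexp z (hf.differentiableAt two_ne_zero)
    have hB := (hdf.hasFDerivAt.clm_apply (hasFDerivAt_const w z)).const_mul (-p)
    rw [((hA.mul hB).congr_of_eventuallyEq he).fderiv]
    simp
    ring
  unfold leviForm
  rw [key, key]
  have := Real.exp_pos (-p * f z)
  nlinarith [mul_nonneg this.le (sq_nonneg (p * fderiv ℝ f z v)),
    mul_nonneg this.le (sq_nonneg (p * fderiv ℝ f z (Complex.I • v)))]

/-- The real orthonormal frame `∂/∂xⁱ, ∂/∂yⁱ` of `ℂⁿ`. -/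
noncomputable def realFrame (n : ℕ) : Fin n ⊕ Fin n → CSpace n :=
  Sum.elim (fun i => EuclideanSpace.single i 1) fun i => Complex.I • EuclideanSpace.single i 1

theorem sum_inner_smul_realFrame (w : CSpace n) :
    ∑ k, inner ℝ w (realFrame n k) • realFrame n k = w := by
  have h1 : ∀ i, inner ℝ w (EuclideanSpace.single i (1 : ℂ)) = (w i).re := by
    intro i
    simp [PiLp.inner_apply, Complex.inner, apply_ite]
  have h2 : ∀ i, inner ℝ w (Complex.I • EuclideanSpace.single i (1 : ℂ)) = (w i).im := by
    intro i
    simp [PiLp.inner_apply, Complex.inner, apply_ite]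
  rw [Fintype.sum_sum_type]
  simp only [realFrame, Sum.elim_inl, Sum.elim_inr, h1, h2]
  rw [← Finset.sum_add_distrib]
  conv_rhs => rw [← sum_smul_single w]
  exact Finset.sum_congr rfl fun i _ => (smul_eq_re_add_im _ _).symm

theorem sum_fderiv_realFrame {u : CSpace n → ℝ} {z : CSpace n} (hu : ContDiffAt ℝ 2 u z) :
    ∑ k, fderiv ℝ (fun y => fderiv ℝ u y (realFrame n k)) z (realFrame n k) =
      ∑ i, leviForm u z (EuclideanSpace.single i 1) := by
  simp only [fderiv_fderiv_apply hu]
  rw [Fintype.sum_sum_type, ← Finset.sum_add_distrib]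
  rfl

end LeviForm

/-! ### The metric in holomorphic charts and its transformation law. -/

section Charts

variable {n : ℕ} {M : Type*} [TopologicalSpace M] [ChartedSpace (CSpace n) M]

/-- The form `g` pulled back to coordinates by the inverse of the chart `e`. -/
noncomputable def HermitianMetric.coordForm (g : HermitianMetric n M)
    (e : OpenPartialHomeomorph M (CSpace n)) (z v w : CSpace n) : ℂ :=
  g.form (e.symm z) (mfderiv 𝓘(ℂ, CSpace n) 𝓘(ℂ, CSpace n) e.symm z v)
    (mfderiv 𝓘(ℂ, CSpace n) 𝓘(ℂ, CSpace n) e.symm z w)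

theorem HermitianMetric.coordForm_eq_sum (g : HermitianMetric n M)
    (e : OpenPartialHomeomorph M (CSpace n)) (z v w : CSpace n) :
    g.coordForm e z v w =
      ∑ i, ∑ j, v i * starRingEnd ℂ (w j) * g.coeff e z i j := by
  have hv : (mfderiv 𝓘(ℂ, CSpace n) 𝓘(ℂ, CSpace n) e.symm z v) =
      ∑ i, v i • mfderiv 𝓘(ℂ, CSpace n) 𝓘(ℂ, CSpace n) e.symm z (EuclideanSpace.single i 1) := by
    conv_lhs => rw [← sum_smul_single v]
    erw [map_sum]
    exact Finset.sum_congr rfl fun i _ => map_smul _ _ _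
  have hw : (mfderiv 𝓘(ℂ, CSpace n) 𝓘(ℂ, CSpace n) e.symm z w) =
      ∑ i, w i • mfderiv 𝓘(ℂ, CSpace n) 𝓘(ℂ, CSpace n) e.symm z (EuclideanSpace.single i 1) := by
    conv_lhs => rw [← sum_smul_single w]
    erw [map_sum]
    exact Finset.sum_congr rfl fun i _ => map_smul _ _ _
  unfold HermitianMetric.coordForm
  rw [hv, hw, map_sum]
  refine (Finset.sum_congr rfl fun j _ => ?_).trans Finset.sum_comm
  rw [map_sum, LinearMap.sum_apply]
  refine Finset.sum_congr rfl fun i _ => ?_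
  rw [LinearMap.map_smulₛₗ, LinearMap.map_smul, LinearMap.smul_apply]
  simp only [smul_eq_mul, HermitianMetric.coeff, Matrix.of_apply]
  ring

/-- The vector is conjugated because `g` is linear in its first slot, whereas `star x ⬝ᵥ G *ᵥ x` is
conjugate-linear there. -/
theorem HermitianMetric.star_dotProduct_coeff (g : HermitianMetric n M)
    (e : OpenPartialHomeomorph M (CSpace n)) (z v : CSpace n) :
    dotProduct (star fun i => starRingEnd ℂ (v i))
      ((g.coeff e z).mulVec fun i => starRingEnd ℂ (v i)) = g.coordForm e z v v := by
  rw [g.coordForm_eq_sum]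
  simp only [dotProduct, Matrix.mulVec, Finset.mul_sum]
  refine Finset.sum_congr rfl fun i _ => Finset.sum_congr rfl fun j _ => ?_
  simp
  ring

theorem HermitianMetric.coordForm_single (g : HermitianMetric n M)
    (e : OpenPartialHomeomorph M (CSpace n)) (z : CSpace n) (i j : Fin n) :
    g.coordForm e z (EuclideanSpace.single i 1) (EuclideanSpace.single j 1) = g.coeff e z i j :=
  rfl

theorem contDiffAt_transition [IsManifold 𝓘(ℂ, CSpace n) ω M]
    {e e' : OpenPartialHomeomorph M (CSpace n)} (he : e ∈ atlas (CSpace n) M)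
    (he' : e' ∈ atlas (CSpace n) M) {z : CSpace n} (hz : z ∈ e.target)
    (hz' : e.symm z ∈ e'.source) : ContDiffAt ℂ ω (fun x => e' (e.symm x)) z := by
  have h := (contDiffGroupoid ω 𝓘(ℂ, CSpace n)).compatible he he'
  have h1 := (contMDiffOn_of_mem_contDiffGroupoid h).contDiffOn
  have hmem : z ∈ (e.symm.trans e').source := by simp [hz, hz']
  exact (h1 z hmem).contDiffAt ((e.symm.trans e').open_source.mem_nhds hmem)

theorem isManifold_real [IsManifold 𝓘(ℂ, CSpace n) ω M] : IsManifold 𝓘(ℝ, CSpace n) ∞ M := by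
  refine isManifold_of_contDiffOn _ _ _ fun e e' he he' z hz => ?_
  simp only [modelWithCornersSelf_coe_symm, Set.preimage_id, modelWithCornersSelf_coe,
    Set.range_id, Set.inter_univ] at hz
  have hz2 : z ∈ e.target ∧ e.symm z ∈ e'.source := by simpa using hz
  exact (((contDiffAt_transition he he' hz2.1 hz2.2).restrict_scalars ℝ).of_le
    (by simp)).contDiffWithinAt

theorem contDiffOn_comp_chart_symm [IsManifold 𝓘(ℂ, CSpace n) ω M]
    {e : OpenPartialHomeomorph M (CSpace n)} (he : e ∈ atlas (CSpace n) M) {φ : M → ℝ}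
    (hφ : ContMDiff 𝓘(ℝ, CSpace n) 𝓘(ℝ, ℝ) ∞ φ) :
    ContDiffOn ℝ ∞ (fun z => φ (e.symm z)) e.target := by
  have := isManifold_real (n := n) (M := M)
  have h := contMDiffOn_symm_of_mem_maximalAtlas (I := 𝓘(ℝ, CSpace n)) (n := ∞)
    (IsManifold.subset_maximalAtlas he)
  exact (hφ.comp_contMDiffOn h).contDiffOn

theorem HermitianMetric.coordForm_transition [IsManifold 𝓘(ℂ, CSpace n) ω M]
    (g : HermitianMetric n M)
    {e e' : OpenPartialHomeomorph M (CSpace n)} (he : e ∈ atlas (CSpace n) M)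
    (he' : e' ∈ atlas (CSpace n) M) {z : CSpace n} (hz : z ∈ e.target)
    (hz' : e.symm z ∈ e'.source) (v w : CSpace n) :
    g.coordForm e z v w = g.coordForm e' (e' (e.symm z))
      (fderiv ℂ (fun x => e' (e.symm x)) z v) (fderiv ℂ (fun x => e' (e.symm x)) z w) := by
  have : IsManifold 𝓘(ℂ, CSpace n) 1 M := IsManifold.of_le (n := ω) (by simp)
  have hF := (contDiffAt_transition he he' hz hz').differentiableAt (by simp)
  have hzt : e' (e.symm z) ∈ e'.target := e'.map_source hz'
  have h1 := (mdifferentiable_of_mem_atlas (I := 𝓘(ℂ, CSpace n)) he').mdifferentiableAt_symm hzt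
  have hcomp := h1.hasMFDerivAt.comp z hF.hasFDerivAt.hasMFDerivAt
  have heq : e.symm =ᶠ[nhds z] (e'.symm ∘ fun x => e' (e.symm x)) := by
    filter_upwards [(e.symm.trans e').open_source.mem_nhds
      (show z ∈ (e.symm.trans e').source by simp [hz, hz'])] with x hx
    have hx' : e.symm x ∈ e'.source := by
      simp only [OpenPartialHomeomorph.trans_source] at hx
      exact hx.2
    simp [hx']
  have hm := (hcomp.congr_of_eventuallyEq heq).mfderiv
  -- The two base points are equal but not definitionally so; viewing both tangent spaces as `CSpace
  -- n` allows the forms to be compared.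
  have aux : ∀ p q : M, p = q → ∀ a b : CSpace n,
      (g.form p : CSpace n →ₗ[ℂ] CSpace n →ₗ⋆[ℂ] ℂ) a b =
        (g.form q : CSpace n →ₗ[ℂ] CSpace n →ₗ⋆[ℂ] ℂ) a b := by
    rintro p q rfl a b; rfl
  unfold HermitianMetric.coordForm
  rw [hm]
  exact aux _ _ (e'.left_inv hz').symm _ _

theorem HermitianMetric.posDef_coeff [IsManifold 𝓘(ℂ, CSpace n) ω M] (g : HermitianMetric n M)
    {e : OpenPartialHomeomorph M (CSpace n)} (he : e ∈ atlas (CSpace n) M) {z : CSpace n}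
    (hz : z ∈ e.target) : (g.coeff e z).PosDef := by
  have : IsManifold 𝓘(ℂ, CSpace n) 1 M := IsManifold.of_le (n := ω) (by simp)
  refine Matrix.PosDef.of_dotProduct_mulVec_pos ?_ fun x hx => ?_
  · ext i j
    exact g.conj_symm _ _ _
  · set v : CSpace n := WithLp.toLp 2 (star x) with hv
    have hxv : x = fun i => starRingEnd ℂ (v i) := by ext i; simp [hv]
    have hv0 : v ≠ 0 := by
      intro h0
      apply hx
      rw [hxv, h0]
      ext i; simp
    rw [hxv, g.star_dotProduct_coeff]
    have hinj := (mdifferentiable_of_mem_atlas (I := 𝓘(ℂ, CSpace n)) he).symm.mfderiv_injective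
      (x := z) (by simpa using hz)
    have hne : mfderiv 𝓘(ℂ, CSpace n) 𝓘(ℂ, CSpace n) e.symm z v ≠ 0 := by
      intro h0
      exact hv0 (hinj (h0.trans (map_zero _).symm))
    have hpos := g.pos _ _ hne
    have him := Complex.conj_eq_iff_im.1 (g.conj_symm _
      (mfderiv 𝓘(ℂ, CSpace n) 𝓘(ℂ, CSpace n) e.symm z v)
      (mfderiv 𝓘(ℂ, CSpace n) 𝓘(ℂ, CSpace n) e.symm z v))
    exact Complex.lt_def.2 ⟨hpos, him.symm⟩

/-- The coefficient matrices are related by `Jᵀ G' J̄`, so the determinant gains `|det J|²`. This is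
the real Jacobian of a holomorphic map, exactly the factor in the change of variables formula. -/
theorem HermitianMetric.det_coeff_transition [IsManifold 𝓘(ℂ, CSpace n) ω M]
    (g : HermitianMetric n M)
    {e e' : OpenPartialHomeomorph M (CSpace n)} (he : e ∈ atlas (CSpace n) M)
    (he' : e' ∈ atlas (CSpace n) M) {z : CSpace n} (hz : z ∈ e.target)
    (hz' : e.symm z ∈ e'.source) :
    (g.coeff e z).det.re =
      |((fderiv ℂ (fun x => e' (e.symm x)) z).restrictScalars ℝ).det| *
        (g.coeff e' (e' (e.symm z))).det.re := by
  set L := fderiv ℂ (fun x => e' (e.symm x)) z with hL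
  set J : Matrix (Fin n) (Fin n) ℂ :=
    Matrix.of fun k i => (L (EuclideanSpace.single i 1)) k with hJ
  have hdetJ : LinearMap.det (L : CSpace n →ₗ[ℂ] CSpace n) = J.det := by
    rw [← LinearMap.det_toMatrix (EuclideanSpace.basisFun (Fin n) ℂ).toBasis]
    congr 1
  have hdet : ((L.restrictScalars ℝ).det : ℝ) = Complex.normSq J.det := by
    rw [← hdetJ, ← Algebra.norm_complex_apply, ← LinearMap.det_restrictScalars]
    rfl
  have hmat : g.coeff e z = J.transpose * g.coeff e' (e' (e.symm z)) * J.map (starRingEnd ℂ) := by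
    ext i j
    rw [← g.coordForm_single, g.coordForm_transition he he' hz hz', g.coordForm_eq_sum]
    simp only [Matrix.mul_apply, Matrix.transpose_apply, Matrix.map_apply, Finset.sum_mul]
    rw [Finset.sum_comm]
    refine Finset.sum_congr rfl fun k _ => Finset.sum_congr rfl fun l _ => ?_
    simp only [hJ, Matrix.of_apply]
    ring
  have hconj : (J.map (starRingEnd ℂ)).det = starRingEnd ℂ J.det :=
    ((starRingEnd ℂ).map_det J).symm
  rw [hmat, Matrix.det_mul, Matrix.det_mul, Matrix.det_transpose, hconj, hdet,
    abs_of_nonneg (Complex.normSq_nonneg _)]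
  have : J.det * (g.coeff e' (e' (e.symm z))).det * starRingEnd ℂ J.det =
      (Complex.normSq J.det : ℂ) * (g.coeff e' (e' (e.symm z))).det := by
    rw [← Complex.mul_conj]; ring
  rw [this, Complex.re_ofReal_mul]

/-- The deformed form in coordinates is bounded above by its trace times `g`. -/
theorem HermitianMetric.leviForm_le [IsManifold 𝓘(ℂ, CSpace n) ω M] (g : HermitianMetric n M)
    {φ : M → ℝ} (hφ : ContMDiff 𝓘(ℝ, CSpace n) 𝓘(ℝ, ℝ) ∞ φ) (hadm : g.IsAdmissible φ)
    {e : OpenPartialHomeomorph M (CSpace n)} (he : e ∈ atlas (CSpace n) M) {z : CSpace n}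
    (hz : z ∈ e.target) (v : CSpace n) :
    leviForm (fun x => φ (e.symm x)) z v ≤
      4 * (g.traceDeformed φ (e.symm z) - 1) * (g.coordForm e z v v).re := by
  -- `traceDeformed` is computed in the preferred chart at `p`, so the Levi form is first moved to
  -- that chart.
  set p := e.symm z with hp
  set e' := chartAt (CSpace n) p with he'_def
  have he' : e' ∈ atlas (CSpace n) M := chart_mem_atlas _ _
  have hz' : e.symm z ∈ e'.source := mem_chart_source _ p
  have hzt : e' p ∈ e'.target := e'.map_source hz'
  have hF := contDiffAt_transition he he' hz hz'
  have hf' : ContDiffAt ℝ 2 (fun x => φ (e'.symm x)) (e' (e.symm z)) :=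
    ((contDiffOn_comp_chart_symm he' hφ).contDiffAt (e'.open_target.mem_nhds hzt)).of_le
      ENat.LEInfty.out
  set L := fderiv ℂ (fun x => e' (e.symm x)) z with hL
  have hcongr : leviForm (fun x => φ (e.symm x)) z v =
      leviForm (fun x => φ (e'.symm x)) (e' p) (L v) := by
    rw [hp, ← leviForm_comp (hF.of_le (by simp)) hf']
    have heq : (fun x => φ (e.symm x)) =ᶠ[nhds z]
        (fun x => φ (e'.symm (e' (e.symm x)))) := by
      filter_upwards [(e.symm.trans e').open_source.mem_nhds
        (show z ∈ (e.symm.trans e').source by simp [hz, hz'])] with x hx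
      have hx' : e.symm x ∈ e'.source := by
        simp only [OpenPartialHomeomorph.trans_source] at hx
        exact hx.2
      simp [hx']
    unfold leviForm
    rw [heq.fderiv.fderiv_eq]
  -- This reads `g + leviForm / 4 ≤ (tr_g g') g` on the vector `L v`, which explains both the `4`
  -- and the `- 1` in the bound.
  have hquad := quadratic_le_trace_mul (g.posDef_coeff he' hzt) (hadm e' he' _ hzt).posSemidef
    (fun i => starRingEnd ℂ (L v i))
  have hsplit : dotProduct (star fun i => starRingEnd ℂ (L v i))
      ((g.deformedCoeff φ e' (e' p)).mulVec fun i => starRingEnd ℂ (L v i)) =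
      g.coordForm e' (e' p) (L v) (L v) +
        ((leviForm (fun x => φ (e'.symm x)) (e' p) (L v) / 4 : ℝ) : ℂ) := by
    rw [HermitianMetric.deformedCoeff, Matrix.add_mulVec, dotProduct_add, g.star_dotProduct_coeff,
      ← sum_dz_dzbar_eq_leviForm hf']
    congr 1
    simp only [dotProduct, Matrix.mulVec, Finset.mul_sum]
    refine Finset.sum_congr rfl fun i _ => Finset.sum_congr rfl fun j _ => ?_
    simp [complexHessian]
    ring
  rw [hsplit, g.star_dotProduct_coeff, Complex.add_re, Complex.ofReal_re] at hquad
  rw [hcongr, g.coordForm_transition he he' hz hz']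
  have htr : g.traceDeformed φ p =
    ((g.coeff e' (e' p))⁻¹ * g.deformedCoeff φ e' (e' p)).trace.re := rfl
  rw [htr]
  linarith

end Charts

/-! ### The volume measure: comparison of charts and finiteness. -/

section Volume

theorem measurableSet_preimage_inter_target {n : ℕ} {M : Type*} [TopologicalSpace M]
    [MeasurableSpace M] [BorelSpace M] (e : OpenPartialHomeomorph M (CSpace n)) {T : Set M}
    (hT : MeasurableSet T) : MeasurableSet (e.symm ⁻¹' T ∩ e.target) := by
  have h1 : Measurable (e.target.domRestrict e.symm) :=
    (continuousOn_iff_continuous_domRestrict.1 e.continuousOn_symm).measurable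
  have h2 := e.open_target.measurableSet.subtype_image (h1 hT)
  convert h2 using 1
  ext z
  simp [and_comm, Set.domRestrict]

variable {n : ℕ} {M : Type*} [TopologicalSpace M] [ChartedSpace (CSpace n) M]

/-- The density of `ωⁿ` with respect to Lebesgue measure in the chart `e`. -/
noncomputable def HermitianMetric.density (g : HermitianMetric n M)
    (e : OpenPartialHomeomorph M (CSpace n)) (z : CSpace n) : ℝ :=
  (n.factorial : ℝ) * 2 ^ n * (g.coeff e z).det.re

theorem HermitianMetric.continuousOn_coeff (g : HermitianMetric n M)
    {e : OpenPartialHomeomorph M (CSpace n)} (he : e ∈ atlas (CSpace n) M) :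
    ContinuousOn (g.coeff e) e.target :=
  continuousOn_pi.2 fun i => continuousOn_pi.2 fun j => (g.smooth e he i j).continuousOn

theorem HermitianMetric.continuousOn_density (g : HermitianMetric n M)
    {e : OpenPartialHomeomorph M (CSpace n)} (he : e ∈ atlas (CSpace n) M) :
    ContinuousOn (g.density e) e.target :=
  continuousOn_const.mul (Complex.continuous_re.comp_continuousOn
    ((continuous_id.matrix_det).comp_continuousOn (g.continuousOn_coeff he)))

theorem HermitianMetric.density_pos [IsManifold 𝓘(ℂ, CSpace n) ω M] (g : HermitianMetric n M)
    {e : OpenPartialHomeomorph M (CSpace n)} (he : e ∈ atlas (CSpace n) M) {z : CSpace n}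
    (hz : z ∈ e.target) : 0 < g.density e z := by
  have h := (Complex.lt_def.1 (g.posDef_coeff he hz).det_pos).1
  rw [Complex.zero_re] at h
  unfold HermitianMetric.density
  positivity

variable [MeasurableSpace M] [BorelSpace M]

theorem HermitianMetric.aemeasurable_chart_symm (g : HermitianMetric n M)
    (e : OpenPartialHomeomorph M (CSpace n)) :
    AEMeasurable e.symm (((volume : Measure (CSpace n)).restrict e.target).withDensity fun z =>
      ENNReal.ofReal (g.density e z)) :=
  (e.continuousOn_symm.aemeasurable e.open_target.measurableSet).mono_ac
    (withDensity_absolutelyContinuous _ _)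

theorem HermitianMetric.localVolume_apply (g : HermitianMetric n M)
    (e : OpenPartialHomeomorph M (CSpace n)) {T : Set M} (hT : MeasurableSet T) :
    g.localVolume e T =
      ∫⁻ z in e.symm ⁻¹' T ∩ e.target, ENNReal.ofReal (g.density e z) := by
  have h := Measure.map_apply_of_aemeasurable (g.aemeasurable_chart_symm e) hT
  rw [withDensity_apply', Measure.restrict_restrict' e.open_target.measurableSet] at h
  exact h

/-- Change of variables along the transition map. Only an inequality holds, since the domain of `e`
may miss part of `T`. -/
theorem HermitianMetric.localVolume_apply_le [IsManifold 𝓘(ℂ, CSpace n) ω M]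
    (g : HermitianMetric n M) {e e' : OpenPartialHomeomorph M (CSpace n)}
    (he : e ∈ atlas (CSpace n) M) (he' : e' ∈ atlas (CSpace n) M) {T : Set M}
    (hT : MeasurableSet T) (hTs : T ⊆ e'.source) : g.localVolume e T ≤ g.localVolume e' T := by
  rw [g.localVolume_apply e hT, g.localVolume_apply e' hT]
  set s := e.symm ⁻¹' T ∩ e.target with hs
  have hsm : MeasurableSet s := measurableSet_preimage_inter_target e hT
  set F : CSpace n → CSpace n := fun x => e' (e.symm x) with hF
  have hd : ∀ z ∈ s, HasFDerivWithinAt F ((fderiv ℂ F z).restrictScalars ℝ) s z := fun z hz =>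
    (((contDiffAt_transition he he' hz.2 (hTs hz.1)).differentiableAt
      (by simp)).hasFDerivAt.restrictScalars ℝ).hasFDerivWithinAt
  have hinj : Set.InjOn F s := fun x hx y hy hxy =>
    e.symm.injOn hx.2 hy.2 (e'.injOn (hTs hx.1) (hTs hy.1) hxy)
  have hcv := lintegral_image_eq_lintegral_abs_det_fderiv_mul volume hsm hd hinj
    (fun z => ENNReal.ofReal (g.density e' z))
  have hcongr : ∫⁻ z in s, ENNReal.ofReal (g.density e z) =
      ∫⁻ z in s, ENNReal.ofReal |((fderiv ℂ F z).restrictScalars ℝ).det| *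
        ENNReal.ofReal (g.density e' (F z)) := by
    refine setLIntegral_congr_fun hsm fun z hz => ?_
    simp only
    rw [← ENNReal.ofReal_mul (abs_nonneg _)]
    congr 1
    unfold HermitianMetric.density
    rw [g.det_coeff_transition he he' hz.2 (hTs hz.1)]
    ring
  rw [hcongr, ← hcv]
  refine lintegral_mono_set ?_
  rintro _ ⟨z, hz, rfl⟩
  refine ⟨?_, e'.map_source (hTs hz.1)⟩
  simpa [hF, e'.left_inv (hTs hz.1)] using hz.1

/-- The supremum runs over a possibly infinite atlas, so one finite measure dominating all local
volumes is needed. Near `p` the volume of the preferred chart dominates all others, and compactness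
reduces to finitely many such neighbourhoods. -/
theorem HermitianMetric.isFiniteMeasure_volumeMeasure [IsManifold 𝓘(ℂ, CSpace n) ω M]
    [CompactSpace M] (g : HermitianMetric n M) : IsFiniteMeasure g.volumeMeasure := by
  have key : ∃ ν : Measure M, IsFiniteMeasure ν ∧
      ∀ e ∈ atlas (CSpace n) M, (g.localVolume e).restrict Set.univ ≤ ν := by
    refine isCompact_univ.induction_on (p := fun S => ∃ ν : Measure M, IsFiniteMeasure ν ∧
      ∀ e ∈ atlas (CSpace n) M, (g.localVolume e).restrict S ≤ ν) ?_ ?_ ?_ ?_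
    · exact ⟨0, inferInstance, fun e _ => by simp⟩
    · rintro s t hst ⟨ν, hν, h⟩
      exact ⟨ν, hν, fun e he => (Measure.restrict_mono_set _ hst).trans (h e he)⟩
    · rintro s t ⟨ν, hν, h⟩ ⟨ν', hν', h'⟩
      exact ⟨ν + ν', inferInstance, fun e he =>
        (Measure.restrict_union_le s t).trans (add_le_add (h e he) (h' e he))⟩
    · intro p _
      set e' := chartAt (CSpace n) p with he'_def
      have he' : e' ∈ atlas (CSpace n) M := chart_mem_atlas _ _
      obtain ⟨ρ, hρ, hball⟩ := Metric.nhds_basis_closedBall.mem_iff.1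
        (e'.open_target.mem_nhds (mem_chart_target (CSpace n) p))
      set S : Set M := e'.source ∩ e' ⁻¹' Metric.ball (e' p) ρ with hS
      have hSo : IsOpen S := e'.isOpen_inter_preimage Metric.isOpen_ball
      refine ⟨S, mem_nhdsWithin_of_mem_nhds (hSo.mem_nhds
        ⟨mem_chart_source _ p, Metric.mem_ball_self hρ⟩), (g.localVolume e').restrict S, ?_, ?_⟩
      · refine ⟨?_⟩
        rw [Measure.restrict_apply_univ, g.localVolume_apply e' hSo.measurableSet]
        have hint : IntegrableOn (g.density e') (Metric.closedBall (e' p) ρ) :=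
          ((g.continuousOn_density he').mono hball).integrableOn_compact
            (isCompact_closedBall _ _)
        refine lt_of_le_of_lt (lintegral_mono_set ?_) hint.lintegral_lt_top
        rintro z ⟨hz, hzt⟩
        have := hz.2
        simp only [Set.mem_preimage, e'.right_inv hzt] at this
        exact Metric.ball_subset_closedBall this
      · intro e he
        refine Measure.le_iff.2 fun T hT => ?_
        rw [Measure.restrict_apply hT, Measure.restrict_apply hT]
        exact g.localVolume_apply_le he he' (hT.inter hSo.measurableSet)
          (Set.inter_subset_right.trans Set.inter_subset_left)
  obtain ⟨ν, hν, h⟩ := key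
  have hle : g.volumeMeasure ≤ ν := iSup₂_le fun e he => by
    simpa using h e he
  exact isFiniteMeasure_of_le ν hle

theorem HermitianMetric.lintegral_localVolume (g : HermitianMetric n M)
    {e : OpenPartialHomeomorph M (CSpace n)} (he : e ∈ atlas (CSpace n) M) {f : M → ENNReal}
    (hf : Measurable f) :
    ∫⁻ x, f x ∂g.localVolume e =
      ∫⁻ z in e.target, ENNReal.ofReal (g.density e z) * f (e.symm z) := by
  have h1 : ∫⁻ x, f x ∂g.localVolume e = ∫⁻ z, f (e.symm z)
      ∂(((volume : Measure (CSpace n)).restrict e.target).withDensity fun z =>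
        ENNReal.ofReal (g.density e z)) :=
    lintegral_map' hf.aemeasurable (g.aemeasurable_chart_symm e)
  rw [h1, lintegral_withDensity_eq_lintegral_mul₀]
  · rfl
  · exact ((g.continuousOn_density he).aemeasurable e.open_target.measurableSet).ennreal_ofReal
  · exact hf.comp_aemeasurable (e.continuousOn_symm.aemeasurable e.open_target.measurableSet)

end Volume

/-! ### Uniform lower bound for the integral of `e^{-α(φ - inf φ)}`. -/

section LowerBound

variable {n : ℕ} {M : Type*} [TopologicalSpace M] [ChartedSpace (CSpace n) M]

theorem HermitianMetric.coeff_self_re_pos [IsManifold 𝓘(ℂ, CSpace n) ω M] (g : HermitianMetric n M)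
    {e : OpenPartialHomeomorph M (CSpace n)} (he : e ∈ atlas (CSpace n) M) {z : CSpace n}
    (hz : z ∈ e.target) (i : Fin n) : 0 < (g.coeff e z i i).re :=
  (Complex.lt_def.1 ((g.posDef_coeff he hz).diag_pos (i := i))).1

/-- The coordinate Laplacian of `e^{-q(φ - m)}` is bounded below when `φ ≥ m` satisfies the
second-order estimate. -/
theorem HermitianMetric.sum_leviForm_exp_ge [IsManifold 𝓘(ℂ, CSpace n) ω M]
    (g : HermitianMetric n M) {φ : M → ℝ} (hφ : ContMDiff 𝓘(ℝ, CSpace n) 𝓘(ℝ, ℝ) ∞ φ)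
    (hadm : g.IsAdmissible φ) {A C q m : ℝ} (hq : 0 ≤ q) (hAq : A ≤ q) (hm : ∀ x, m ≤ φ x)
    (htr : ∀ x, g.traceDeformed φ x ≤ C * Real.exp (A * (φ x - m)))
    {e : OpenPartialHomeomorph M (CSpace n)} (he : e ∈ atlas (CSpace n) M) {z : CSpace n}
    (hz : z ∈ e.target) :
    -(4 * q * |C| * ∑ i, (g.coeff e z i i).re) ≤
      ∑ i, leviForm (fun x => Real.exp (-q * (φ (e.symm x) - m))) z
        (EuclideanSpace.single i 1) := by
  rw [Finset.mul_sum, ← Finset.sum_neg_distrib]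
  refine Finset.sum_le_sum fun i _ => ?_
  have hf : ContDiffAt ℝ 2 (fun x => φ (e.symm x)) z :=
    ((contDiffOn_comp_chart_symm he hφ).contDiffAt (e.open_target.mem_nhds hz)).of_le
      ENat.LEInfty.out
  refine le_trans ?_ (leviForm_exp_neg_ge (f := fun x => φ (e.symm x) - m)
    (hf.sub contDiffAt_const) q _)
  have hshift : leviForm (fun x => φ (e.symm x) - m) z (EuclideanSpace.single i 1) =
      leviForm (fun x => φ (e.symm x)) z (EuclideanSpace.single i 1) := by
    have : fderiv ℝ (fun x => φ (e.symm x) - m) = fderiv ℝ (fun x => φ (e.symm x)) :=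
      funext fun y => fderiv_sub_const m
    unfold leviForm
    rw [this]
  rw [hshift]
  have hG := g.coeff_self_re_pos he hz i
  have hlevi := g.leviForm_le hφ hadm he hz (EuclideanSpace.single i 1)
  rw [g.coordForm_single] at hlevi
  set ψ := φ (e.symm z) - m with hψ
  have hψ0 : 0 ≤ ψ := sub_nonneg.2 (hm _)
  have h1 : leviForm (fun x => φ (e.symm x)) z (EuclideanSpace.single i 1) ≤
      4 * (|C| * Real.exp (A * ψ)) * (g.coeff e z i i).re := by
    refine hlevi.trans (mul_le_mul_of_nonneg_right ?_ hG.le)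
    have h2 := htr (e.symm z)
    have h3 : C * Real.exp (A * ψ) ≤ |C| * Real.exp (A * ψ) :=
      mul_le_mul_of_nonneg_right (le_abs_self C) (Real.exp_pos _).le
    linarith
  -- Here `q ≥ A` and `ψ ≥ 0` absorb the exponential growth allowed by the second-order estimate.
  have h4 : Real.exp (-q * ψ) * Real.exp (A * ψ) ≤ 1 := by
    rw [← Real.exp_add]
    exact Real.exp_le_one_iff.2 (by nlinarith)
  have h5 : q * Real.exp (-q * ψ) * leviForm (fun x => φ (e.symm x)) z
      (EuclideanSpace.single i 1) ≤
      q * Real.exp (-q * ψ) * (4 * (|C| * Real.exp (A * ψ)) * (g.coeff e z i i).re) :=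
    mul_le_mul_of_nonneg_left h1 (mul_nonneg hq (Real.exp_pos _).le)
  have h6 : 4 * q * |C| * (g.coeff e z i i).re * (Real.exp (-q * ψ) * Real.exp (A * ψ)) ≤
      4 * q * |C| * (g.coeff e z i i).re * 1 :=
    mul_le_mul_of_nonneg_left h4 (by positivity)
  linarith

/-- A scale-invariant form of the sub-mean-value inequality for functions that are only defined
near a ball, with the average taken in the extended nonnegative reals. -/
theorem lintegral_ball_ge {u : CSpace n → ℝ} {c x₀ : CSpace n} {ρ r K : ℝ} {V : Set (CSpace n)}
    (hV : IsOpen V) (hVc : Metric.closedBall c (3 * ρ) ⊆ V) (hρ : 0 < ρ)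
    (hu : ContDiffOn ℝ 2 u V) (hu0 : ∀ z, 0 ≤ u z) (hx : x₀ ∈ Metric.ball c ρ) (hux : u x₀ = 1)
    (hr : 0 < r) (hrρ : r ≤ ρ)
    (hK : ∀ z ∈ Metric.closedBall c (2 * ρ),
      -K ≤ ∑ i, leviForm u z (EuclideanSpace.single i 1))
    (hKr : K * (∫ w : CSpace n, ballPotential w) * r ^ 2 ≤ ∫ w : CSpace n, ballWeight w) :
    ENNReal.ofReal (r ^ Module.finrank ℝ (CSpace n) * ((∫ w : CSpace n, ballWeight w) / 2)) ≤
      ∫⁻ z in Metric.closedBall c (2 * ρ), ENNReal.ofReal (u z) := by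
  -- The cutoff makes `u` globally `C²` without changing it on the ball of radius `2ρ`, which
  -- contains `ball x₀ r`.
  let bump : ContDiffBump c := ⟨2 * ρ, 3 * ρ, by linarith, by linarith⟩
  set U : CSpace n → ℝ := fun z => bump z * u z with hU
  have hUd : ContDiff ℝ 2 U := by
    refine (contMDiff_of_tsupport fun z hz => ContDiffAt.contMDiffAt ?_).contDiff
    have hz' : z ∈ V := hVc (by
      have := closure_mono (Function.support_mul_subset_left _ _) hz
      rwa [← tsupport, bump.tsupport_eq] at this)
    exact bump.contDiff.contDiffAt.mul (hu.contDiffAt (hV.mem_nhds hz'))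
  have hUeq : ∀ z ∈ Metric.closedBall c (2 * ρ), U z = u z := fun z hz => by
    rw [hU]
    simp [bump.one_of_mem_closedBall hz]
  have hball : Metric.ball x₀ r ⊆ Metric.ball c (2 * ρ) := by
    intro z hz
    rw [Metric.mem_ball] at *
    linarith [dist_triangle z x₀ c]
  have hU0 : ∀ z, 0 ≤ U z := fun z => mul_nonneg bump.nonneg (hu0 z)
  have hlap : ∀ z ∈ Metric.ball x₀ r,
      -K ≤ ∑ k, fderiv ℝ (fun y => fderiv ℝ U y (realFrame n k)) z (realFrame n k) := by
    intro z hz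
    rw [sum_fderiv_realFrame hUd.contDiffAt]
    have heq : U =ᶠ[nhds z] u := by
      filter_upwards [Metric.isOpen_ball.mem_nhds (hball hz)] with y hy
      exact hUeq y (Metric.ball_subset_closedBall hy)
    unfold leviForm
    rw [heq.fderiv.fderiv_eq]
    exact hK z (Metric.ball_subset_closedBall (hball hz))
  have hmv := mul_integral_ballWeight_le (μ := (volume : Measure (CSpace n)))
    sum_inner_smul_realFrame hUd hr hlap
  have hUx : U x₀ = 1 := by
    rw [hUeq _ (Metric.ball_subset_closedBall (hball (Metric.mem_ball_self hr))), hux]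
  rw [hUx, one_mul] at hmv
  set h : CSpace n → ℝ := fun z => ballWeight (r⁻¹ • (z - x₀)) * U z with hh
  have hscale : ∫ w, ballWeight w * U (x₀ + r • w) =
      (r ^ Module.finrank ℝ (CSpace n))⁻¹ * ∫ z, h z := by
    have h1 : ∀ w : CSpace n, ballWeight w * U (x₀ + r • w) = h (x₀ + r • w) := by
      intro w
      simp only [hh, add_sub_cancel_left, smul_smul, inv_mul_cancel₀ hr.ne', one_smul]
    simp_rw [h1]
    rw [Measure.integral_comp_smul volume (fun y => h (x₀ + y)) r,
      integral_add_left_eq_self h x₀, abs_of_pos (by positivity), smul_eq_mul]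
  have hrd : 0 < r ^ Module.finrank ℝ (CSpace n) := by positivity
  have hhge : r ^ Module.finrank ℝ (CSpace n) * ((∫ w : CSpace n, ballWeight w) / 2) ≤
      ∫ z, h z := by
    -- By `hKr` the error in the sub-mean-value inequality uses up at most half of `u x₀ * ∫
    -- ballWeight`.
    have h2 : (∫ w : CSpace n, ballWeight w) / 2 ≤ ∫ w, ballWeight w * U (x₀ + r • w) := by
      linarith
    rw [hscale, ← div_eq_inv_mul, le_div_iff₀ hrd] at h2
    linarith
  have hhc : Continuous h := by
    have h1 := (continuous_ballWeight (E := CSpace n))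
    have h2 := hUd.continuous
    rw [hh]
    fun_prop
  have hh0 : ∀ z, 0 ≤ h z := fun z => mul_nonneg (ballWeight_nonneg _) (hU0 z)
  have hhi : Integrable h :=
    hhc.integrable_of_hasCompactSupport (HasCompactSupport.mul_left bump.hasCompactSupport.mul_right)
  refine (ENNReal.ofReal_le_ofReal hhge).trans ?_
  rw [ofReal_integral_eq_lintegral_ofReal hhi (Filter.Eventually.of_forall hh0),
    ← lintegral_indicator Metric.isClosed_closedBall.measurableSet]
  refine lintegral_mono fun z => ?_
  by_cases hz : z ∈ Metric.closedBall c (2 * ρ)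
  · rw [Set.indicator_of_mem hz]
    refine ENNReal.ofReal_le_ofReal ?_
    simp only [hh]
    rw [hUeq z hz]
    exact mul_le_of_le_one_left (hu0 z) (ballWeight_le_one _)
  · have hz' : z ∉ Metric.ball x₀ r := fun hz1 =>
      hz (Metric.ball_subset_closedBall (hball hz1))
    have : h z = 0 := by
      simp only [hh]
      rw [ballWeight_eq_zero, zero_mul]
      rw [Metric.mem_ball, not_lt, dist_eq_norm] at hz'
      rw [norm_smul, norm_inv, Real.norm_of_nonneg hr.le, ← div_eq_inv_mul]
      exact (one_le_div hr).2 hz'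
    simp [this]

variable [MeasurableSpace M] [BorelSpace M]

theorem HermitianMetric.exists_local_lower_bound [IsManifold 𝓘(ℂ, CSpace n) ω M]
    (g : HermitianMetric n M) (A C : ℝ) {α : ℝ} (hα : 0 < α) (p : M) :
    ∃ S ∈ nhds p, ∃ c : ℝ, 0 < c ∧ ∀ (φ : M → ℝ) (m : ℝ),
      ContMDiff 𝓘(ℝ, CSpace n) 𝓘(ℝ, ℝ) ∞ φ → g.IsAdmissible φ → (∀ x, m ≤ φ x) →
      (∀ x, g.traceDeformed φ x ≤ C * Real.exp (A * (φ x - m))) →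
      ∀ x₀ ∈ S, φ x₀ = m →
        ENNReal.ofReal c ≤
          ∫⁻ x, ENNReal.ofReal (Real.exp (-α * (φ x - m))) ∂g.volumeMeasure := by
  set e := chartAt (CSpace n) p with he_def
  have he : e ∈ atlas (CSpace n) M := chart_mem_atlas _ _
  obtain ⟨R, hR, hball⟩ := Metric.nhds_basis_closedBall.mem_iff.1
    (e.open_target.mem_nhds (mem_chart_target (CSpace n) p))
  set ρ := R / 3 with hρ_def
  have hρ : 0 < ρ := by positivity
  have hball3 : Metric.closedBall (e p) (3 * ρ) ⊆ e.target := by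
    rwa [hρ_def, mul_div_cancel₀ R (by norm_num)]
  have hball2 : Metric.closedBall (e p) (2 * ρ) ⊆ e.target :=
    (Metric.closedBall_subset_closedBall (by linarith)).trans hball3
  have hcpt := isCompact_closedBall (e p) (2 * ρ)
  have hne : (Metric.closedBall (e p) (2 * ρ)).Nonempty :=
    Metric.nonempty_closedBall.2 (by linarith)
  obtain ⟨zmin, hzmin, hmin⟩ := hcpt.exists_isMinOn hne
    ((g.continuousOn_density he).mono hball2)
  set δ := g.density e zmin with hδ_def
  have hδ : 0 < δ := g.density_pos he (hball2 hzmin)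
  have htrc : ContinuousOn (fun z => ∑ i, (g.coeff e z i i).re) (Metric.closedBall (e p) (2 * ρ)) := by
    refine ContinuousOn.mono (continuousOn_finsetSum _ fun i _ => ?_) hball2
    exact Complex.continuous_re.comp_continuousOn (g.smooth e he i i).continuousOn
  obtain ⟨zmax, hzmax, hmax⟩ := hcpt.exists_isMaxOn hne htrc
  set B := ∑ i, (g.coeff e zmax i i).re with hB_def
  have hB : 0 ≤ B := Finset.sum_nonneg fun i _ => (g.coeff_self_re_pos he (hball2 hzmax) i).le
  -- `A ≤ q` serves the Laplacian bound; `α ≤ q` lets `e^{-q(φ-m)}` be replaced by the larger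
  -- `e^{-α(φ-m)}` at the end.
  set q := max α A with hq_def
  have hq : 0 < q := lt_max_of_lt_left hα
  set K := 4 * q * |C| * B with hK_def
  have hK : 0 ≤ K := by positivity
  set I := ∫ w : CSpace n, ballWeight w with hI_def
  set P := ∫ w : CSpace n, ballPotential w with hP_def
  have hI : 0 < I := integral_ballWeight_pos
  have hP : 0 ≤ P := integral_nonneg ballPotential_nonneg
  -- Since `r ≤ 1`, `K P r² ≤ K P r ≤ I`; the `+ 1` keeps the denominator positive when `K P = 0`.
  set r := min ρ (min 1 (I / (K * P + 1))) with hr_def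
  have hr : 0 < r := by positivity
  have hKr : K * P * r ^ 2 ≤ I := by
    have h1 : r ≤ 1 := (min_le_right _ _).trans (min_le_left _ _)
    have h2 : r ≤ I / (K * P + 1) := (min_le_right _ _).trans (min_le_right _ _)
    have h3 : 0 ≤ K * P := by positivity
    rw [le_div_iff₀ (by positivity)] at h2
    have h4 : r ^ 2 ≤ r := by nlinarith
    nlinarith
  refine ⟨e.source ∩ e ⁻¹' Metric.ball (e p) ρ,
    (e.isOpen_inter_preimage Metric.isOpen_ball).mem_nhds
      ⟨mem_chart_source _ p, Metric.mem_ball_self hρ⟩,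
    δ * (r ^ Module.finrank ℝ (CSpace n) * (I / 2)), by positivity, ?_⟩
  intro φ m hφ hadm hm htr x₀ hx₀ hφx
  have hu : ContDiffOn ℝ 2 (fun z => Real.exp (-q * (φ (e.symm z) - m))) e.target :=
    (contDiffOn_const.mul (((contDiffOn_comp_chart_symm he hφ).of_le ENat.LEInfty.out).sub
      contDiffOn_const)).exp
  have hmean := lintegral_ball_ge (u := fun z => Real.exp (-q * (φ (e.symm z) - m)))
    (c := e p) (x₀ := e x₀) (ρ := ρ) (r := r) (K := K) e.open_target hball3 hρ hu
    (fun z => (Real.exp_pos _).le) hx₀.2 (by simp [e.left_inv hx₀.1, hφx]) hr (min_le_left _ _)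
    (fun z hz => ?_) hKr
  · have hmeas : Measurable fun x => ENNReal.ofReal (Real.exp (-α * (φ x - m))) := by
      have := hφ.continuous
      exact ENNReal.measurable_ofReal.comp (by fun_prop : Continuous _).measurable
    calc ENNReal.ofReal (δ * (r ^ Module.finrank ℝ (CSpace n) * (I / 2)))
        = ENNReal.ofReal δ * ENNReal.ofReal (r ^ Module.finrank ℝ (CSpace n) * (I / 2)) :=
          ENNReal.ofReal_mul hδ.le
      _ ≤ ENNReal.ofReal δ * ∫⁻ z in Metric.closedBall (e p) (2 * ρ),
            ENNReal.ofReal (Real.exp (-q * (φ (e.symm z) - m))) := by gcongr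
      _ = ∫⁻ z in Metric.closedBall (e p) (2 * ρ),
            ENNReal.ofReal δ * ENNReal.ofReal (Real.exp (-q * (φ (e.symm z) - m))) :=
          (lintegral_const_mul' _ _ ENNReal.ofReal_ne_top).symm
      _ ≤ ∫⁻ z in Metric.closedBall (e p) (2 * ρ), ENNReal.ofReal (g.density e z) *
            ENNReal.ofReal (Real.exp (-α * (φ (e.symm z) - m))) := by
          refine setLIntegral_mono' Metric.isClosed_closedBall.measurableSet fun z hz => ?_
          have h1 := hm (e.symm z)
          have h2 : α ≤ q := le_max_left _ _
          exact mul_le_mul' (ENNReal.ofReal_le_ofReal (hmin hz))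
            (ENNReal.ofReal_le_ofReal (Real.exp_le_exp.2 (by nlinarith)))
      _ ≤ ∫⁻ z in e.target, ENNReal.ofReal (g.density e z) *
            ENNReal.ofReal (Real.exp (-α * (φ (e.symm z) - m))) := lintegral_mono_set hball2
      _ = ∫⁻ x, ENNReal.ofReal (Real.exp (-α * (φ x - m))) ∂g.localVolume e :=
          (g.lintegral_localVolume he hmeas).symm
      _ ≤ _ := lintegral_mono' (le_iSup₂_of_le e he le_rfl) le_rfl
  · refine le_trans (neg_le_neg ?_) (g.sum_leviForm_exp_ge hφ hadm hq.le (le_max_right _ _) hm htr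
      he (hball2 hz))
    exact mul_le_mul_of_nonneg_left (hmax hz) (by positivity)

/-- The local constants do not depend on `φ`, so the minimum over a finite cover works wherever the
minimum point lies. The membership `x₀ ∈ Set.univ` fits the compactness induction. -/
theorem HermitianMetric.exists_lower_bound [IsManifold 𝓘(ℂ, CSpace n) ω M] [CompactSpace M]
    (g : HermitianMetric n M) (A C : ℝ) {α : ℝ} (hα : 0 < α) :
    ∃ c : ℝ, 0 < c ∧ ∀ (φ : M → ℝ) (m : ℝ),
      ContMDiff 𝓘(ℝ, CSpace n) 𝓘(ℝ, ℝ) ∞ φ → g.IsAdmissible φ → (∀ x, m ≤ φ x) →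
      (∀ x, g.traceDeformed φ x ≤ C * Real.exp (A * (φ x - m))) →
      ∀ x₀ ∈ (Set.univ : Set M), φ x₀ = m →
        ENNReal.ofReal c ≤
          ∫⁻ x, ENNReal.ofReal (Real.exp (-α * (φ x - m))) ∂g.volumeMeasure := by
  refine isCompact_univ.induction_on (p := fun S => ∃ c : ℝ, 0 < c ∧ ∀ (φ : M → ℝ) (m : ℝ),
      ContMDiff 𝓘(ℝ, CSpace n) 𝓘(ℝ, ℝ) ∞ φ → g.IsAdmissible φ → (∀ x, m ≤ φ x) →
      (∀ x, g.traceDeformed φ x ≤ C * Real.exp (A * (φ x - m))) →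
      ∀ x₀ ∈ S, φ x₀ = m →
        ENNReal.ofReal c ≤
          ∫⁻ x, ENNReal.ofReal (Real.exp (-α * (φ x - m))) ∂g.volumeMeasure) ?_ ?_ ?_ ?_
  · exact ⟨1, one_pos, fun φ m _ _ _ _ x₀ hx₀ => hx₀.elim⟩
  · rintro s t hst ⟨c, hc, h⟩
    exact ⟨c, hc, fun φ m h1 h2 h3 h4 x₀ hx₀ => h φ m h1 h2 h3 h4 x₀ (hst hx₀)⟩
  · rintro s t ⟨c, hc, h⟩ ⟨c', hc', h'⟩
    refine ⟨min c c', lt_min hc hc', fun φ m h1 h2 h3 h4 x₀ hx₀ hx => ?_⟩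
    rcases hx₀ with hx₀ | hx₀
    · exact (ENNReal.ofReal_le_ofReal (min_le_left _ _)).trans (h φ m h1 h2 h3 h4 x₀ hx₀ hx)
    · exact (ENNReal.ofReal_le_ofReal (min_le_right _ _)).trans (h' φ m h1 h2 h3 h4 x₀ hx₀ hx)
  · intro p _
    obtain ⟨S, hS, h⟩ := g.exists_local_lower_bound A C hα p
    exact ⟨S, mem_nhdsWithin_of_mem_nhds hS, h⟩

end LowerBound

end HermitianGeometry

/-- `M` is a compact complex manifold of dimension `n ≥ 2` with a Hermitian metric `g`, and `A`, `C`
are the constants of the second-order estimate `tr_g g' ≤ C e^{A(φ - inf φ)}`. The constant `Cα`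
depends only on `(M, g)`, `A`, `C` and `α`, not on `φ`. -/
theorem lemma3p1 (n : ℕ) (hn : 2 ≤ n) (M : Type*) [TopologicalSpace M]
    [ChartedSpace (HermitianGeometry.CSpace n) M]
    [IsManifold 𝓘(ℂ, HermitianGeometry.CSpace n) ω M]
    [T2Space M] [CompactSpace M] [Nonempty M] [MeasurableSpace M] [BorelSpace M]
    (g : HermitianGeometry.HermitianMetric n M) (A C α : ℝ) (hα : 0 < α) :
    ∃ Cα : ℝ, ∀ φ : M → ℝ,
      ContMDiff 𝓘(ℝ, HermitianGeometry.CSpace n) 𝓘(ℝ, ℝ) ∞ φ →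
      (⨆ p, φ p) = 0 →
      g.IsAdmissible φ →
      (∀ p, g.traceDeformed φ p ≤ C * Real.exp (A * (φ p - ⨅ q, φ q))) →
      -(⨅ p, φ p) ≤
        Cα + (1 / α) * Real.log (∫ p, Real.exp (-α * φ p) ∂g.normalizedVolume) := by
  have hfin := g.isFiniteMeasure_volumeMeasure
  obtain ⟨c, hc, hbound⟩ := g.exists_lower_bound A C hα
  set V := g.volumeMeasure.real Set.univ with hV
  -- The constant comes from taking logarithms in `e^{-αm} V⁻¹ c ≤ ∫ e^{-αφ} dμ` and dividing by
  -- `α`.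
  refine ⟨-(1 / α) * Real.log (V⁻¹ * c), fun φ hφ _ hadm htr => ?_⟩
  have hφc : Continuous φ := hφ.continuous
  have hbdd : BddBelow (Set.range φ) := (isCompact_range hφc).bddBelow
  obtain ⟨x₀, -, hx₀⟩ := isCompact_univ.exists_isMinOn Set.univ_nonempty hφc.continuousOn
  set m := ⨅ p, φ p with hm
  have hmle : ∀ x, m ≤ φ x := fun x => ciInf_le hbdd x
  have hx₀m : φ x₀ = m := le_antisymm (le_ciInf fun x => hx₀ (Set.mem_univ x)) (hmle x₀)
  have hlow := hbound φ m hφ hadm hmle htr x₀ (Set.mem_univ _) hx₀m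
  set f : M → ℝ := fun x => Real.exp (-α * (φ x - m)) with hf
  have hfc : Continuous f := by rw [hf]; fun_prop
  have hfi : MeasureTheory.Integrable f g.volumeMeasure := by
    refine MeasureTheory.Integrable.of_bound hfc.aestronglyMeasurable 1
      (Filter.Eventually.of_forall fun x => ?_)
    rw [Real.norm_of_nonneg (Real.exp_pos _).le]
    exact Real.exp_le_one_iff.2 (by nlinarith [hmle x])
  rw [← MeasureTheory.ofReal_integral_eq_lintegral_ofReal hfi
    (Filter.Eventually.of_forall fun x => (Real.exp_pos _).le),
    ENNReal.ofReal_le_ofReal_iff (MeasureTheory.integral_nonneg fun x => (Real.exp_pos _).le)]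
    at hlow
  -- Positivity of the volume follows from the lower bound itself: a zero measure would make an
  -- integral that is at least `c > 0` vanish.
  have hVpos : 0 < V := by
    rcases (MeasureTheory.measureReal_nonneg (μ := g.volumeMeasure)
      (s := Set.univ)).eq_or_lt with h0 | h0
    · have hzero : g.volumeMeasure = 0 := by
        rw [← MeasureTheory.Measure.measure_univ_eq_zero]
        exact (MeasureTheory.measureReal_eq_zero_iff).1 h0.symm
      rw [hzero, MeasureTheory.integral_zero_measure] at hlow
      linarith
    · exact h0
  have hint : ∫ p, Real.exp (-α * φ p) ∂g.normalizedVolume =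
      Real.exp (-α * m) * (V⁻¹ * ∫ x, f x ∂g.volumeMeasure) := by
    have h1 : ∀ x, Real.exp (-α * φ x) = Real.exp (-α * m) * f x := by
      intro x
      rw [hf, ← Real.exp_add]
      congr 1; ring
    simp_rw [h1]
    rw [MeasureTheory.integral_const_mul, HermitianGeometry.HermitianMetric.normalizedVolume,
      MeasureTheory.integral_smul_measure, ENNReal.toReal_inv]
    rfl
  have hlog : -α * m + Real.log (V⁻¹ * c) ≤
      Real.log (∫ p, Real.exp (-α * φ p) ∂g.normalizedVolume) := by
    rw [hint, Real.log_mul (Real.exp_pos _).ne' (mul_pos (inv_pos.2 hVpos)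
      (hc.trans_le hlow)).ne', Real.log_exp]
    have : Real.log (V⁻¹ * c) ≤ Real.log (V⁻¹ * ∫ x, f x ∂g.volumeMeasure) := by
      gcongr
    linarith
  have := mul_le_mul_of_nonneg_left hlog (one_div_pos.2 hα).le
  have h2 : 1 / α * (-α * m + Real.log (V⁻¹ * c)) = -m + 1 / α * Real.log (V⁻¹ * c) := by
    field_simp
  linarith
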